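/- Let $n\ge 0$ and $[1,n]=\{1,\dots,n\}$. **Composition matrices.** $\mathrm{Comp}_n$ is the set of square upper triangular matrices (of any dimension) whose entries are subsets of $[1,n]$, whose non-empty entries partition $[1,n]$ (sets in different positions are disjoint), and which have no row and no column consisting of empty sets only. $\mathrm{Int}_n$ is the set of square upper triangular matrices of non-negative integers with sum of entries $n$ and without zero rows or zero columns. For $A\in\mathrm{Comp}_n$, $\mathrm{Card}(A)\in \mathrm{Int}_n$ is the matrix of the cardinalities of its entries. **Ascent sequences.** $\mathrm{Asc}_n$ is the set of sequences $(a_1,\dots,a_n)$ of non-negative integers with $a_1=0$ and $a_{i+1}\le 1+|\{j<i : a_j<a_{j+1}\}|$ for $0<i<n$. $\mathrm{RLR}(\alpha)$ is the sequence of the lengths of the maximal runs of equal adjacent values of $\alpha$. $\mathrm{Mad}_n$ is the set of pairs $(\alpha,\chi)$ with $\alpha\in \mathrm{Asc}_n$ and $\chi=(X_1,\dots,X_k)$ an ordered set partition of $[1,n]$ (into non-empty blocks) with $(|X_1|,\dots,|X_k|)=\mathrm{RLR}(\alpha)$. **The Dukes–Parviainen map $\Gamma$.** For a matrix $A\in \mathrm{Int}_n$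 of dimension $d\ge 1$, let $p=\mathrm{index}(A)$ be the smallest $i$ with $A_{i,d}\neq 0$. Let $A'$ be the matrix obtained as follows: if row $p$ of $A$ has sum greater than $1$, decrease $A_{p,d}$ by $1$; otherwise, if $p=d$, delete row $d$ and column $d$; otherwise, replace $A_{i,d}$ by $A_{i,p}$ for $1\le i<p$ and then delete row $p$ and column $p$. The sequence $\Gamma(A)$ is $\Gamma(A')$ followed by $p-1$, and $\Gamma$ of the empty matrix is the empty sequence. Conversely, a sequence is turned into a matrix by starting with the empty matrix and performing for each term $a$ the following step on the current matrix $A$, of dimension $d$, with $m=a+1$: if $m=d+1$, append a row and a column of zeros and then put $1$ in the new corner $(d+1,d+1)$; if $m\le \mathrm{index}(A)$ (and $m\le d$), increase $A_{m,d}$ by $1$; if $\mathrm{index}(A)<m\le d$, insert a new zero row and a new zero column in position $m$, move the entries of the last column above row $m$ to column $m$, and put a $1$ in row $m$ of the last column. If a step turns a zero entry into a non-zero one or introduces a new non-zero entry, that entry is *created* in this step (entries that are moved keep their identity). For a non-zero entry $(i,j)$ of $A\in\mathrm{Int}_n$, let $T_A(i,j)=t$ if it is the $t$-th entry created in the construction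 of $A$ from $\Gamma(A)$; let $T_A(i,j)=0$ if $A_{ij}=0$. **The maps.** For $A\in\mathrm{Comp}_n$ with $k$ non-empty entries, put $\varphi(A)=(\Gamma(\mathrm{Card}(A)),(X_1,\dots,X_k))$, where $X_t=A_{ij}$ for $T_{\mathrm{Card}(A)}(i,j)=t$. For $(w,\chi)\in\mathrm{Mad}_n$ with $\chi=(X_1,\dots,X_k)$, put $B=\Gamma^{-1}(w)$ and let $\psi(w,\chi)$ be the matrix of the dimension of $B$ with $(i,j)$ entry $X_t$, where $t=T_B(i,j)$ and $X_0=\emptyset$. For $(\alpha,\chi)\in\mathrm{Mad}_n$, $\theta(\alpha,\chi)$ is the labelled poset constructed as follows (Bousquet-Mélou, Claesson, Dukes and Kitaev). Let $\hat\chi$ be the word obtained by writing the blocks of $\chi$ one after another, each in increasing order. Start with the empty poset; in step $s$ add an element labelled with the $s$-th letter of $\hat\chi$ to the current poset $P$, according to $i=a_s$. Here the strict down-sets of the elements of $P$ form a chain $D_0\subsetneq\dots\subsetneq D_\ell$ (with $\ell=-1$ if $P$ is empty), an element with strict down-set $D_j$ has level $j$, and $\ell^*$ is the lowest level of a maximal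 element. If $i=\ell+1$, the new element is put above all elements of $P$. If $i\le \ell$ and $i\le\ell^*$, it is a new maximal element with strict down-set $D_i$. If $\ell^*<i\le \ell$, it is a new maximal element with strict down-set $D_i$, and moreover every maximal element of $P$ of level less than $i$ is put below every element of $P$ of level at least $i$. **Theorem.** 1. $\Gamma:\mathrm{Int}_n\to\mathrm{Asc}_n$ is a bijection, and the stepwise construction above is its inverse. 2. $\varphi:\mathrm{Comp}_n\to\mathrm{Mad}_n$ is a bijection, and $\psi$ is its inverse. 3. $\theta\circ\varphi$ is a bijection from $\mathrm{Comp}_n$ to the set of $(2+2)$-free posets on $[1,n]$, i.e. of the partial orders on $[1,n]$ without an induced subposet isomorphic to the disjoint union of two $2$-element chains. -/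

import Mathlib

/-- A square matrix of arbitrary dimension, with entries in `α`. -/
structure SqMat (α : Type) where
  /-- the number of rows (and of columns) -/
  dim : ℕ
  /-- the entries; rows and columns are numbered `0, …, dim - 1` -/
  entry : Matrix (Fin dim) (Fin dim) α

namespace SqMat

/-- The entry in row `i` and column `j`, numbered from `0`; it is `0` outside of the matrix. -/
def get {α : Type} [Zero α] (A : SqMat α) (i j : ℕ) : α :=
  if h : i < A.dim ∧ j < A.dim then A.entry ⟨i, h.1⟩ ⟨j, h.2⟩ else 0

/-- The `k × k` matrix whose `(i, j)` entry is `f i j`. -/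
def ofFun {α : Type} (k : ℕ) (f : ℕ → ℕ → α) : SqMat α :=
  ⟨k, fun i j => f i j⟩

/-- Entry-wise application of a function. -/
def map {α β : Type} (f : α → β) (A : SqMat α) : SqMat β :=
  ⟨A.dim, fun i j => f (A.entry i j)⟩

/-- The topmost row (numbered from `0`) with a non-zero entry in the last column. -/
def index {α : Type} [Zero α] [DecidableEq α] (A : SqMat α) : ℕ :=
  (List.range A.dim).findIdx (fun i => A.get i (A.dim - 1) ≠ 0)

/-- The sum of all entries. -/
def total (A : SqMat ℕ) : ℕ := ∑ i, ∑ j, A.entry i j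

/-- The number of non-zero entries. -/
def nz {α : Type} [Zero α] [DecidableEq α] (A : SqMat α) : ℕ :=
  (Finset.univ.filter fun p : Fin A.dim × Fin A.dim => A.entry p.1 p.2 ≠ 0).card

/-- The upper triangular matrices of non-negative integers with sum of entries `n` and without
zero rows or zero columns. -/
def intMatrices (n : ℕ) : Set (SqMat ℕ) :=
  {A | (∀ i j, j < i → A.entry i j = 0) ∧
    (∀ i, ∃ j, A.entry i j ≠ 0) ∧ (∀ j, ∃ i, A.entry i j ≠ 0) ∧ A.total = n}

/-- The composition matrices on `[1, n]`: upper triangular matrices of sets, without rows or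
columns consisting of empty sets only, whose non-empty entries partition `[1, n]`. -/
def compMatrices (n : ℕ) : Set (SqMat (Finset ℕ)) :=
  {A | (∀ i j, j < i → A.entry i j = ∅) ∧
    (∀ i, ∃ j, (A.entry i j).Nonempty) ∧ (∀ j, ∃ i, (A.entry i j).Nonempty) ∧
    (∀ i j i' j', (i, j) ≠ (i', j') → Disjoint (A.entry i j) (A.entry i' j')) ∧
    (∀ x, x ∈ Finset.Icc 1 n ↔ ∃ i j, x ∈ A.entry i j)}

/-- The entry-wise cardinality. -/
def card (A : SqMat (Finset ℕ)) : SqMat ℕ := A.map Finset.card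

/-- The removal step of Dukes and Parviainen. Let `p` be the index of `A` and `last` its last
column. If row `p` has sum greater than `1`, the entry `(p, last)` is decreased by `1`. Otherwise,
if `p = last`, the last row and column are deleted. Otherwise, the entries of column `p` above
row `p` are moved to the last column, and then row `p` and column `p` are deleted. -/
def remove (A : SqMat ℕ) : SqMat ℕ :=
  let last := A.dim - 1
  let p := A.index
  let up : ℕ → ℕ := fun i => if i < p then i else i + 1
  if 1 < ∑ j ∈ Finset.range A.dim, A.get p j then
    ofFun A.dim fun i j => if i = p ∧ j = last then A.get i j - 1 else A.get i j
  else if p = last then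
    ofFun last A.get
  else
    ofFun last fun i j => if i < p ∧ j + 1 = last then A.get i p else A.get (up i) (up j)

/-- The sequence of the indices met in the course of `m` removal steps, last index first. -/
def gammaAux : ℕ → SqMat ℕ → List ℕ
  | 0, _ => []
  | m + 1, A => gammaAux m A.remove ++ [A.index]

/-- The map `Γ` of Dukes and Parviainen: `Γ(A) = (Γ(A'), index A)`, where `A'` arises from `A` by
the removal step (which lowers the sum of the entries by `1`). -/
def gamma (A : SqMat ℕ) : List ℕ := gammaAux A.total A

/-- The addition step of Dukes and Parviainen. Each entry is a pair (value, time of creation),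
which is `(0, 0)` for a zero entry. Let `last` be the last column of `A`.
If `a ≤ index A`, the value at `(a, last)` is increased by `1`; this creates a new non-zero entry
if the value was `0`. If `index A < a < dim A`, a new row `a` and a new column `a` are inserted, the
entries of the last column above row `a` are moved to column `a`, and a new `1` is created in row
`a` of the last column. If `a = dim A`, a new row and column are appended with a new `1` in the
corner. The non-zero entry created in this step, if any, gets the next time. -/
def addStep (A : SqMat (ℕ × ℕ)) (a : ℕ) : SqMat (ℕ × ℕ) :=
  let k := A.dim
  let new : ℕ × ℕ := (1, A.nz + 1)
  let down : ℕ → ℕ := fun i => if i < a then i else i - 1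
  if a < k then
    if a ≤ A.index then
      ofFun k fun i j =>
        if i = a ∧ j = k - 1 then
          (if A.get i j = 0 then new else ((A.get i j).1 + 1, (A.get i j).2))
        else A.get i j
    else
      ofFun (k + 1) fun i j =>
        if i = a then (if j = k then new else 0)
        else if j = a then (if i < a then A.get i (k - 1) else 0)
        else if j = k ∧ i < a then 0
        else A.get (down i) (down j)
  else
    ofFun (k + 1) fun i j => if i = k ∧ j = k then new else A.get i j

/-- The matrix of pairs (value, time of creation) built from a sequence by addition steps, starting
with the empty matrix. -/
def build (w : List ℕ) : SqMat (ℕ × ℕ) :=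
  w.foldl addStep (ofFun 0 fun _ _ => 0)

/-- The matrix that Dukes and Parviainen construct from a sequence. -/
def gammaInv (w : List ℕ) : SqMat ℕ := (build w).map Prod.fst

/-- The matrix `T_A`: for a non-zero entry of `A`, its time of creation when `A` is constructed
from the sequence `Γ(A)`; for a zero entry, `0`. -/
def creationTime (A : SqMat ℕ) : SqMat ℕ :=
  ofFun A.dim fun i j => ((build A.gamma).get i j).2

/-- The sequence `(X_1, …, X_{nz})` of the non-empty entries of `A` by time of creation:
`X_t` is the entry `(i, j)` for which `T_{Card A}(i, j) = t`. -/
def setSystem (A : SqMat (Finset ℕ)) : List (Finset ℕ) :=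
  (List.range A.card.nz).map fun s =>
    (Finset.univ.filter fun p : Fin A.dim × Fin A.dim =>
      A.card.creationTime.get p.1 p.2 = s + 1).biUnion fun p => A.entry p.1 p.2

/-- The map `A ↦ (Γ(Card A), (X_1, …, X_{nz}))`. -/
def phi (A : SqMat (Finset ℕ)) : List ℕ × List (Finset ℕ) :=
  (A.card.gamma, A.setSystem)

/-- The map `ψ`: `ψ(w, (X_1, …, X_k))` has the entries `X_t` with `t = T_B(i, j)`, where
`B = Γ⁻¹(w)` and `X_0 = ∅`. -/
def psi (m : List ℕ × List (Finset ℕ)) : SqMat (Finset ℕ) :=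
  let B := gammaInv m.1
  ofFun B.dim fun i j =>
    if B.creationTime.get i j = 0 then ∅ else m.2.getD (B.creationTime.get i j - 1) ∅

end SqMat

namespace AscentSeq

/-- The number of ascents of a sequence. -/
def asc (a : List ℕ) : ℕ := (a.zip a.tail).countP fun p => p.1 < p.2

/-- The ascent sequences of length `n`. -/
def ascents (n : ℕ) : Set (List ℕ) :=
  {a | a.length = n ∧ (∀ h : 0 < a.length, a[0] = 0) ∧
    ∀ i, 0 < i → ∀ h : i < a.length, a[i] ≤ 1 + asc (a.take i)}

/-- The run-length record: the lengths of the maximal runs of equal adjacent values. -/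
def rlr (a : List ℕ) : List ℕ := (a.splitBy fun x y => x == y).map List.length

/-- The pairs of an ascent sequence of length `n` and an ordered set partition of `[1, n]` whose
block sizes are given by the run-length record of the ascent sequence. -/
def mad (n : ℕ) : Set (List ℕ × List (Finset ℕ)) :=
  {m | m.1 ∈ ascents n ∧ (∀ X ∈ m.2, X.Nonempty) ∧ m.2.Pairwise Disjoint ∧
    (∀ x, x ∈ Finset.Icc 1 n ↔ ∃ X ∈ m.2, x ∈ X) ∧ m.2.map Finset.card = rlr m.1}

end AscentSeq

/-- A finite set of labels with a relation on it, given as the set of the pairs `(x, y)` such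
that `x` is (strictly) below `y`. -/
structure LabelledPoset where
  /-- the elements -/
  carrier : Finset ℕ
  /-- the pairs `(x, y)` with `x` strictly below `y` -/
  rel : Finset (ℕ × ℕ)

namespace LabelledPoset

/-- The strict down-set of `x`. -/
def down (P : LabelledPoset) (x : ℕ) : Finset ℕ :=
  P.carrier.filter fun y => (y, x) ∈ P.rel

/-- The set of all strict down-sets of elements. -/
def downs (P : LabelledPoset) : Finset (Finset ℕ) := P.carrier.image P.down

/-- The level of `x`: the number of strict down-sets that are smaller than that of `x`. -/
def level (P : LabelledPoset) (x : ℕ) : ℕ := (P.downs.filter fun E => E ⊂ P.down x).card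

/-- The maximal elements. -/
def maximals (P : LabelledPoset) : Finset ℕ :=
  P.carrier.filter fun x => ∀ y ∈ P.carrier, (x, y) ∉ P.rel

/-- The common strict down-set of the elements at level `i`. -/
def downAt (P : LabelledPoset) (i : ℕ) : Finset ℕ :=
  P.carrier.filter fun y => ∃ x ∈ P.carrier, P.level x = i ∧ (y, x) ∈ P.rel

/-- The addition step of Bousquet-Mélou, Claesson, Dukes and Kitaev with parameter `i`, where the
new element gets the label `z`. Let the levels of `P` be `0, …, l`, and let `m` be the lowest level
that contains a maximal element. If `i ≤ m`, a new maximal element is added to level `i`.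
If `m < i ≤ l`, a new maximal element `z` with the strict down-set of level `i` is added, and every
maximal element of level less than `i` is put below every old element of level at least `i`.
If `i = l + 1`, a new element is added above all elements of `P`. -/
def addStep (P : LabelledPoset) (i z : ℕ) : LabelledPoset where
  carrier := insert z P.carrier
  rel :=
    if i < P.downs.card then
      if ∀ x ∈ P.maximals, i ≤ P.level x then
        P.rel ∪ P.downAt i ×ˢ {z}
      else
        P.rel ∪ P.downAt i ×ˢ {z} ∪
          (P.maximals.filter fun x => P.level x < i) ×ˢ (P.carrier.filter fun y => i ≤ P.level y)
    else P.rel ∪ P.carrier ×ˢ {z}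

/-- The map that sends `(α, χ)` to the order relation of the poset that is constructed from `α`
element by element, where the element inserted at the `i`-th step gets as its label the `i`-th
letter of the word obtained by writing the blocks of `χ` one after another, each increasingly. -/
def ofMad (m : List ℕ × List (Finset ℕ)) : Finset (ℕ × ℕ) :=
  ((m.1.zip (m.2.flatMap fun X : Finset ℕ => X.sort)).foldl (fun (P : LabelledPoset) p => P.addStep p.1 p.2) ⟨∅, ∅⟩).rel

/-- The `(2+2)`-free posets on `[1, n]`, given by their strict order relations: no induced
subposet is isomorphic to the disjoint union of two `2`-element chains. -/
def twoTwoFree (n : ℕ) : Set (Finset (ℕ × ℕ)) :=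
  {R | R ⊆ Finset.Icc 1 n ×ˢ Finset.Icc 1 n ∧ (∀ x, (x, x) ∉ R) ∧
    (∀ x y z, (x, y) ∈ R → (y, z) ∈ R → (x, z) ∈ R) ∧
    IsEmpty (((· < ·) : Fin 2 ⊕ Fin 2 → Fin 2 ⊕ Fin 2 → Prop) ↪r fun x y : ℕ => (x, y) ∈ R)}

end LabelledPoset

namespace SqMat

/-! The first two claims rest on one step analysis. Call a matrix regular if it is upper triangular
without zero rows or columns. Adding a term `a ≤ dim` to a regular matrix gives a regular matrix
with index `a` and total one larger, and removal undoes this (`remove_intStep`). Conversely, every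
non-empty regular matrix arises from its removal by adding its index (`remove_spec`). The dimension
grows exactly when `a` exceeds the index, which is the preceding term, so it grows at the first term
and at each ascent. Hence the dimension equals the ascent bound on the next term, and the admissible
sequences are exactly the ascent sequences (`gammaInv_spec`, `gamma_spec`).

A step changes the entry in row `a` of the last column. That entry was non-zero only if `a` is the
index, that is, if `a` repeats the preceding term. So each run of equal terms creates one entry and
then raises it to the length of the run. The invariant `Records` states this: times of creation
number the non-zero entries, and the entry of time `t` is the length of the `t`-th run. Blocks with
these sizes can therefore be written into the entries and read off again (`psi_phi`, `psi_spec`).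

For the posets, a label in entry `(i, j)` is regarded as the interval `[i, j]`, with `x` below `y`
if the interval of `x` ends before that of `y` starts. The poset step acts on the intervals as the
matrix step acts on positions (`Rep.rel_addStep`), so `A` is sent to the interval order given by its
own positions (`ofMad_phi`). Regularity says that every number below the dimension is both a lower
and an upper end. Such a representation is determined by the order (`Rep.eqOn`), and every
(2+2)-free order has one, because its strict down-sets form a chain (`exists_rep`). -/

@[simp] theorem dim_ofFun {α : Type} (k : ℕ) (f : ℕ → ℕ → α) : (ofFun k f).dim = k := rfl

@[simp] theorem dim_map {α β : Type} (f : α → β) (A : SqMat α) : (A.map f).dim = A.dim := rfl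

/-! ### Entries, index and the generic addition step -/

section General

variable {α β : Type} [Zero α] [Zero β]

theorem get_ofFun (k : ℕ) (f : ℕ → ℕ → α) (i j : ℕ) :
    (ofFun k f).get i j = if i < k ∧ j < k then f i j else 0 := by
  unfold get ofFun
  split_ifs <;> rfl

theorem get_of_lt (A : SqMat α) {i j : ℕ} (hi : i < A.dim) (hj : j < A.dim) :
    A.get i j = A.entry ⟨i, hi⟩ ⟨j, hj⟩ := dif_pos ⟨hi, hj⟩

theorem get_coe (A : SqMat α) (i j : Fin A.dim) : A.get i j = A.entry i j :=
  get_of_lt A i.2 j.2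

theorem get_of_not (A : SqMat α) {i j : ℕ} (h : ¬ (i < A.dim ∧ j < A.dim)) : A.get i j = 0 :=
  dif_neg h

theorem lt_of_get_ne (A : SqMat α) {i j : ℕ} (h : A.get i j ≠ 0) : i < A.dim ∧ j < A.dim := by
  by_contra h'
  exact h (get_of_not A h')

theorem get_map (f : α → β) (hf : f 0 = 0) (A : SqMat α) (i j : ℕ) :
    (A.map f).get i j = f (A.get i j) := by
  unfold get map
  split_ifs
  · rfl
  · exact hf.symm

theorem ext_get {A B : SqMat α} (hd : A.dim = B.dim)
    (h : ∀ i j, i < A.dim → j < A.dim → A.get i j = B.get i j) : A = B := by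
  obtain ⟨k, a⟩ := A
  obtain ⟨l, b⟩ := B
  obtain rfl : k = l := hd
  congr
  ext i j
  have := h i j i.2 j.2
  rwa [get_coe ⟨k, a⟩ i j, get_coe ⟨k, b⟩ i j] at this

/-- Upper triangular matrices without zero rows or zero columns. -/
structure Reg (A : SqMat α) : Prop where
  tri : ∀ i j, j < i → A.get i j = 0
  row : ∀ i, i < A.dim → ∃ j, A.get i j ≠ 0
  col : ∀ j, j < A.dim → ∃ i, A.get i j ≠ 0

theorem reg_iff (A : SqMat α) :
    A.Reg ↔ (∀ i j, j < i → A.entry i j = 0) ∧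
      (∀ i, ∃ j, A.entry i j ≠ 0) ∧ (∀ j, ∃ i, A.entry i j ≠ 0) := by
  constructor
  · intro h
    refine ⟨fun i j hij => ?_, fun i => ?_, fun j => ?_⟩
    · rw [← get_coe]; exact h.tri _ _ hij
    · obtain ⟨j, hj⟩ := h.row i i.2
      have := (lt_of_get_ne A hj).2
      exact ⟨⟨j, this⟩, by rwa [get_of_lt A i.2 this] at hj⟩
    · obtain ⟨i, hi⟩ := h.col j j.2
      have := (lt_of_get_ne A hi).1
      exact ⟨⟨i, this⟩, by rwa [get_of_lt A this j.2] at hi⟩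
  · rintro ⟨h1, h2, h3⟩
    refine ⟨fun i j hij => ?_, fun i hi => ?_, fun j hj => ?_⟩
    · by_contra h
      obtain ⟨hi, hj⟩ := lt_of_get_ne A h
      exact h (by rw [get_of_lt A hi hj]; exact h1 ⟨i, hi⟩ ⟨j, hj⟩ hij)
    · obtain ⟨j, hj⟩ := h2 ⟨i, hi⟩
      exact ⟨j, by rwa [get_of_lt A hi j.2]⟩
    · obtain ⟨i, hi⟩ := h3 ⟨j, hj⟩
      exact ⟨i, by rwa [get_of_lt A i.2 hj]⟩

theorem Reg.le_of_get_ne {A : SqMat α} (h : A.Reg) {i j : ℕ} (hij : A.get i j ≠ 0) : i ≤ j :=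
  not_lt.1 fun h' => hij (h.tri _ _ h')

/-- Triangularity leaves only the corner for the non-zero entry of the last row. This is what
guarantees that `index` finds a row. -/
theorem Reg.corner {A : SqMat α} (h : A.Reg) (hd : 0 < A.dim) :
    A.get (A.dim - 1) (A.dim - 1) ≠ 0 := by
  obtain ⟨j, hj⟩ := h.row (A.dim - 1) (by omega)
  have := h.le_of_get_ne hj
  have := (lt_of_get_ne A hj).2
  rwa [show j = A.dim - 1 by omega] at hj

variable [DecidableEq α] [DecidableEq β]

theorem index_eq {A : SqMat α} {p : ℕ} (h : A.get p (A.dim - 1) ≠ 0)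
    (h' : ∀ i, i < p → A.get i (A.dim - 1) = 0) : A.index = p := by
  have hp := (lt_of_get_ne A h).1
  unfold index
  rw [List.findIdx_eq (by simpa using hp)]
  refine ⟨by simpa using h, fun j hj => ?_⟩
  simpa using h' j hj

theorem Reg.index_lt {A : SqMat α} (h : A.Reg) (hd : 0 < A.dim) : A.index < A.dim := by
  unfold index
  have : List.findIdx (fun i => decide (A.get i (A.dim - 1) ≠ 0)) (List.range A.dim)
      < (List.range A.dim).length := by
    rw [List.findIdx_lt_length]
    exact ⟨A.dim - 1, by simp; omega, by simpa using h.corner hd⟩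
  simpa using this

theorem Reg.get_index {A : SqMat α} (h : A.Reg) (hd : 0 < A.dim) :
    A.get A.index (A.dim - 1) ≠ 0 := by
  have h1 := h.index_lt hd
  have := List.findIdx_getElem (xs := List.range A.dim)
    (p := fun i => decide (A.get i (A.dim - 1) ≠ 0)) (w := by simpa [index] using h1)
  simpa [index] using this

theorem get_of_lt_index {A : SqMat α} {i : ℕ} (hi : i < A.index) : A.get i (A.dim - 1) = 0 := by
  have := List.not_of_lt_findIdx (xs := List.range A.dim)
    (p := fun i => decide (A.get i (A.dim - 1) ≠ 0)) hi
  simpa using this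

theorem index_map {A : SqMat α} (f : α → β) (hf : f 0 = 0)
    (h : ∀ i j, f (A.get i j) = 0 → A.get i j = 0) : (A.map f).index = A.index := by
  unfold index
  congr 1
  ext i
  simp only [get_map f hf, dim_map]
  congr 1
  simp only [ne_eq, eq_iff_iff, not_iff_not]
  exact ⟨h _ _, fun h => by rw [h, hf]⟩

/-- The addition step, where the entry in the new or changed position is changed by `g`. -/
def gstep (A : SqMat α) (a : ℕ) (g : α → α) : SqMat α :=
  let k := A.dim
  let down : ℕ → ℕ := fun i => if i < a then i else i - 1
  if a < k then
    if a ≤ A.index then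
      ofFun k fun i j => if i = a ∧ j = k - 1 then g (A.get i j) else A.get i j
    else
      ofFun (k + 1) fun i j =>
        if i = a then (if j = k then g 0 else 0)
        else if j = a then (if i < a then A.get i (k - 1) else 0)
        else if j = k ∧ i < a then 0
        else A.get (down i) (down j)
  else
    ofFun (k + 1) fun i j => if i = k ∧ j = k then g 0 else A.get i j

/-- The new position of the entry in position `(i, j)` after the addition step. -/
def move (A : SqMat α) (a i j : ℕ) : ℕ × ℕ :=
  if A.index < a ∧ a < A.dim then
    (if i < a then i else i + 1,
      if i < a ∧ j = A.dim - 1 then a else if j < a then j else j + 1)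
  else (i, j)

/-- The old value of the entry that the addition step changes. -/
def prior (A : SqMat α) (a : ℕ) : α :=
  if a < A.dim ∧ a ≤ A.index then A.get a (A.dim - 1) else 0

theorem dim_gstep (A : SqMat α) (a : ℕ) (g : α → α) :
    (A.gstep a g).dim = if a < A.dim ∧ a ≤ A.index then A.dim else A.dim + 1 := by
  unfold gstep
  by_cases h1 : a < A.dim <;> by_cases h2 : a ≤ A.index <;> simp [h1, h2]

theorem gstep_le (A : SqMat α) {a : ℕ} (g : α → α) (h1 : a < A.dim) (h2 : a ≤ A.index) :
    (A.gstep a g).dim = A.dim ∧ ∀ i j, (A.gstep a g).get i j =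
      if i = a ∧ j = A.dim - 1 then g (A.get i j) else A.get i j := by
  constructor
  · simp [dim_gstep, h1, h2]
  intro i j
  unfold gstep
  simp only [h1, h2, if_true, get_ofFun]
  have := @get_of_not _ _ A i j
  grind

theorem gstep_mid (A : SqMat α) {a : ℕ} (g : α → α) (h1 : a < A.dim) (h2 : A.index < a) :
    (A.gstep a g).dim = A.dim + 1 ∧ ∀ i j, (A.gstep a g).get i j =
      if i = a then (if j = A.dim then g 0 else 0)
      else if j = a then (if i < a then A.get i (A.dim - 1) else 0)
      else if j = A.dim ∧ i < a then 0
      else A.get (if i < a then i else i - 1) (if j < a then j else j - 1) := by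
  constructor
  · simp [dim_gstep, h1, h2]
  intro i j
  unfold gstep
  simp only [h1, not_le.2 h2, if_true, if_false, get_ofFun]
  have := @get_of_not _ _ A (if i < a then i else i - 1) (if j < a then j else j - 1)
  split_ifs <;> first | rfl | omega | (symm; apply get_of_not; omega)

theorem gstep_ge (A : SqMat α) {a : ℕ} (g : α → α) (h1 : A.dim ≤ a) :
    (A.gstep a g).dim = A.dim + 1 ∧ ∀ i j, (A.gstep a g).get i j =
      if i = A.dim ∧ j = A.dim then g 0 else A.get i j := by
  constructor
  · simp [dim_gstep, not_lt.2 h1]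
  intro i j
  unfold gstep
  simp only [not_lt.2 h1, if_false, get_ofFun]
  have := @get_of_not _ _ A i j
  grind

theorem cases_step (A : SqMat α) {a : ℕ} (ha : a ≤ A.dim) :
    (a < A.dim ∧ a ≤ A.index) ∨ (a < A.dim ∧ A.index < a) ∨ a = A.dim := by omega

end General

end SqMat

namespace SqMat

/-! ### Effect of the addition step on positions, index and sums -/

section Step

variable {α : Type} [Zero α] [DecidableEq α] {A : SqMat α} {a : ℕ} {g : α → α}

theorem get_target (ha : a ≤ A.dim) :
    (A.gstep a g).get a ((A.gstep a g).dim - 1) = g (A.prior a) := by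
  rcases cases_step A ha with ⟨h1, h2⟩ | ⟨h1, h2⟩ | h1
  · obtain ⟨hd, h⟩ := gstep_le A g h1 h2
    rw [h, hd]; simp [prior, h1, h2]
  · obtain ⟨hd, h⟩ := gstep_mid A g h1 h2
    rw [h, hd]; simp [prior, not_le.2 h2]
  · obtain ⟨hd, h⟩ := gstep_ge A g h1.ge
    rw [h, hd]; simp [prior, h1]

/-- Only the branch without a new row changes an existing position; in the other two the position
`(a, last)` is fresh. -/
theorem move_eq_target_iff (ha : a ≤ A.dim) {i j : ℕ} (hi : i < A.dim) (hj : j < A.dim) :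
    A.move a i j = (a, (A.gstep a g).dim - 1) ↔
      (a < A.dim ∧ a ≤ A.index) ∧ i = a ∧ j = A.dim - 1 := by
  unfold move
  rw [dim_gstep]
  grind

theorem get_move (ha : a ≤ A.dim) {i j : ℕ} (hi : i < A.dim) (hj : j < A.dim) (hij : i ≤ j)
    (h : A.move a i j ≠ (a, (A.gstep a g).dim - 1)) :
    (A.gstep a g).get (A.move a i j).1 (A.move a i j).2 = A.get i j := by
  have h0 := mt (move_eq_target_iff (g := g) ha hi hj).2 h
  rcases cases_step A ha with ⟨h1, h2⟩ | ⟨h1, h2⟩ | h1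
  · obtain ⟨-, h⟩ := gstep_le A g h1 h2
    rw [h]; unfold move; grind
  · obtain ⟨-, h⟩ := gstep_mid A g h1 h2
    rw [h]; unfold move; grind
  · obtain ⟨-, h⟩ := gstep_ge A g h1.ge
    rw [h]; unfold move; grind

theorem exists_move_eq (hA : A.Reg) (ha : a ≤ A.dim) {i j : ℕ} (h0 : (A.gstep a g).get i j ≠ 0) :
    (i, j) = (a, (A.gstep a g).dim - 1) ∨ ∃ i' j', A.get i' j' ≠ 0 ∧ A.move a i' j' = (i, j) := by
  rcases cases_step A ha with ⟨h1, h2⟩ | ⟨h1, h2⟩ | h1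
  · obtain ⟨hd, h⟩ := gstep_le A g h1 h2
    rw [h] at h0; rw [hd]; unfold move; grind
  · obtain ⟨hd, h⟩ := gstep_mid A g h1 h2
    rw [h] at h0; rw [hd]
    by_cases hi : i = a
    · left; grind
    right
    by_cases hj : j = a
    · refine ⟨i, A.dim - 1, ?_⟩
      unfold move; grind
    · have := lt_of_get_ne A (i := if i < a then i else i - 1) (j := if j < a then j else j - 1)
        (by grind)
      refine ⟨if i < a then i else i - 1, if j < a then j else j - 1, by grind, ?_⟩
      have := hA.le_of_get_ne (i := if i < a then i else i - 1) (j := if j < a then j else j - 1)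
        (by grind)
      unfold move; grind
  · obtain ⟨hd, h⟩ := gstep_ge A g h1.ge
    rw [h] at h0; rw [hd]; unfold move; grind

theorem move_inj {i j i' j' : ℕ} (_hi : i ≤ j) (_hj : j < A.dim)
    (_hi' : i' ≤ j') (_hj' : j' < A.dim) (h : A.move a i j = A.move a i' j') :
    i = i' ∧ j = j' := by
  unfold move at h
  grind

theorem move_lt (A : SqMat α) (a : ℕ) (g : α → α) {i j : ℕ} (hi : i < A.dim) (hj : j < A.dim) :
    (A.move a i j).1 < (A.gstep a g).dim ∧ (A.move a i j).2 < (A.gstep a g).dim := by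
  unfold move
  rw [dim_gstep]
  grind

/-- The first branch requires `a ≤ index`, and the last column vanishes above the index; so only `a
= index` meets a non-zero entry. -/
theorem prior_eq_zero_iff (hA : A.Reg) : A.prior a = 0 ↔ ¬ (a = A.index ∧ 0 < A.dim) := by
  unfold prior
  split_ifs with h
  · have h1 := hA.get_index (by omega)
    rcases h.2.eq_or_lt with h2 | h2
    · simp only [h2, h1, false_iff]; grind
    · simp only [get_of_lt_index h2, true_iff]; omega
  · have := hA.index_lt
    grind

/-- Non-zero entries survive under `move` and cover the old rows and columns; the changed entry
covers the new row and the last column. -/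
theorem reg_gstep (hA : A.Reg) (ha : a ≤ A.dim) (hg : ∀ e, g e ≠ 0) : (A.gstep a g).Reg := by
  have ht := get_target (g := g) ha
  have hm : ∀ i j, A.get i j ≠ 0 →
      (A.gstep a g).get (A.move a i j).1 (A.move a i j).2 ≠ 0 := by
    intro i j h
    obtain ⟨hi, hj⟩ := lt_of_get_ne A h
    by_cases hq : A.move a i j = (a, (A.gstep a g).dim - 1)
    · rw [hq]; dsimp only; rw [ht]; exact hg _
    · rwa [get_move ha hi hj (hA.le_of_get_ne h) hq]
  have hlast : (A.gstep a g).get a ((A.gstep a g).dim - 1) ≠ 0 := by rw [ht]; exact hg _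
  refine ⟨fun i j hij => ?_, fun i hi => ?_, fun j hj => ?_⟩
  · by_contra h
    rcases exists_move_eq hA ha h with h | ⟨i', j', h, h'⟩
    · have := dim_gstep A a g
      grind
    · have := hA.le_of_get_ne h
      have := lt_of_get_ne A h
      unfold move at h'
      grind
  · by_cases hia : i = a
    · subst hia; exact ⟨_, hlast⟩
    · have : ∃ i', i' < A.dim ∧ ∀ j, (A.move a i' j).1 = i := by
        rw [dim_gstep] at hi
        unfold move
        by_cases h1 : A.index < a ∧ a < A.dim
        · refine ⟨if i < a then i else i - 1, by grind, by grind⟩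
        · exact ⟨i, by grind, by grind⟩
      obtain ⟨i', h1, h2⟩ := this
      obtain ⟨j, h3⟩ := hA.row i' h1
      exact ⟨_, h2 j ▸ hm _ _ h3⟩
  · by_cases hja : j = (A.gstep a g).dim - 1
    · subst hja; exact ⟨_, hlast⟩
    · rw [dim_gstep] at hj hja
      by_cases h1 : A.index < a ∧ a < A.dim
      · by_cases hj1 : j = a
        -- The inserted column is not zero: since `A.index < a`, the topmost entry of the old last
        -- column moves into it.
        · refine ⟨A.index, ?_⟩
          have := hm _ _ (hA.get_index (by omega))
          have h2 : A.move a A.index (A.dim - 1) = (A.index, j) := by unfold move; grind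
          rwa [h2] at this
        · have hj' : (if j < a then j else j - 1) < A.dim := by grind
          obtain ⟨i, hi⟩ := hA.col _ hj'
          have := hm _ _ hi
          have h2 : (A.move a i (if j < a then j else j - 1)).2 = j := by unfold move; grind
          rw [h2] at this
          exact ⟨_, this⟩
      · obtain ⟨i, hi⟩ := hA.col j (by grind)
        have := hm _ _ hi
        have h2 : (A.move a i j).2 = j := by unfold move; grind
        rw [h2] at this
        exact ⟨_, this⟩

theorem index_gstep (ha : a ≤ A.dim) (hg : ∀ e, g e ≠ 0) :
    (A.gstep a g).index = a := by
  apply index_eq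
  · rw [get_target ha]; exact hg _
  · intro i hi
    rcases cases_step A ha with ⟨h1, h2⟩ | ⟨h1, h2⟩ | h1
    · obtain ⟨hd, h⟩ := gstep_le A g h1 h2
      rw [h, hd, if_neg (by omega)]
      exact get_of_lt_index (by omega)
    · obtain ⟨hd, h⟩ := gstep_mid A g h1 h2
      rw [h, hd]; grind
    · obtain ⟨hd, h⟩ := gstep_ge A g h1.ge
      rw [h, hd, if_neg (by omega)]
      exact get_of_not A (by omega)

/-- The sum of the values of a function on the entries. -/
def entrySum {M : Type} [AddCommMonoid M] (F : α → M) (A : SqMat α) : M :=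
  ∑ p ∈ Finset.range A.dim ×ˢ Finset.range A.dim, F (A.get p.1 p.2)

/-- Apart from the changed position, `move` is a bijection between the non-zero entries before and
after the step. The additive form avoids subtraction. -/
theorem entrySum_gstep {M : Type} [AddCommMonoid M] {F : α → M} (hF : F 0 = 0) (hA : A.Reg)
    (ha : a ≤ A.dim) :
    entrySum F (A.gstep a g) + F (A.prior a) = entrySum F A + F (g (A.prior a)) := by
  set d := (A.gstep a g).dim with hd
  have hdd := dim_gstep A a g
  have hq : (a, d - 1) ∈ Finset.range d ×ˢ Finset.range d := by
    simp only [Finset.mem_product, Finset.mem_range]; grind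
  have e1 : entrySum F (A.gstep a g) = F (g (A.prior a)) +
      ∑ p ∈ (Finset.range d ×ˢ Finset.range d).erase (a, d - 1),
        F ((A.gstep a g).get p.1 p.2) := by
    unfold entrySum
    rw [← Finset.add_sum_erase _ _ hq]
    dsimp only
    rw [get_target ha]
  have e2 : entrySum F A = F (A.prior a) +
      ∑ p ∈ (Finset.range d ×ˢ Finset.range d).erase (a, d - 1),
        F ((A.gstep a g).get p.1 p.2) := by
    have key : ∑ p ∈ (Finset.range A.dim ×ˢ Finset.range A.dim).filter
          (fun p => A.get p.1 p.2 ≠ 0 ∧ A.move a p.1 p.2 ≠ (a, d - 1)), F (A.get p.1 p.2) =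
        ∑ p ∈ (Finset.range d ×ˢ Finset.range d).erase (a, d - 1),
          F ((A.gstep a g).get p.1 p.2) := by
      apply Finset.sum_of_injOn (fun p => A.move a p.1 p.2)
      · rintro ⟨i, j⟩ h ⟨i', j'⟩ h' hh
        simp only [Finset.coe_filter, Finset.mem_product, Finset.mem_range, Set.mem_ofPred_eq]
          at h h'
        have := move_inj (hA.le_of_get_ne h.2.1) h.1.2 (hA.le_of_get_ne h'.2.1) h'.1.2 hh
        grind
      · rintro ⟨i, j⟩ h
        simp only [Finset.coe_filter, Finset.mem_product, Finset.mem_range, Set.mem_ofPred_eq]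
          at h
        have := move_lt A a g h.1.1 h.1.2
        simp only [Finset.coe_erase, Finset.coe_product, Set.mem_sdiff, Set.mem_prod,
          Finset.mem_coe, Finset.mem_range, Set.mem_singleton_iff]
        exact ⟨this, h.2.2⟩
      · rintro ⟨i, j⟩ h h'
        rw [Finset.mem_erase] at h
        by_contra h0
        have h0 : (A.gstep a g).get i j ≠ 0 := fun h1 => h0 (by dsimp only; rw [h1, hF])
        rcases exists_move_eq hA ha h0 with h1 | ⟨i', j', h1, h2⟩
        · exact h.1 h1
        · apply h'
          refine ⟨(i', j'), ?_, h2⟩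
          have := lt_of_get_ne A h1
          simp only [Finset.coe_filter, Finset.mem_product, Finset.mem_range, Set.mem_ofPred_eq]
          exact ⟨this, h1, h2 ▸ h.1⟩
      · rintro ⟨i, j⟩ h
        simp only [Finset.mem_filter, Finset.mem_product, Finset.mem_range] at h
        dsimp only
        rw [get_move ha h.1.1 h.1.2 (hA.le_of_get_ne h.2.1) h.2.2]
    rw [← key]
    unfold entrySum
    by_cases hc : a < A.dim ∧ a ≤ A.index
    · have hq' : (a, A.dim - 1) ∈ Finset.range A.dim ×ˢ Finset.range A.dim := by
        simp only [Finset.mem_product, Finset.mem_range]; grind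
      rw [← Finset.add_sum_erase _ _ hq']
      congr 1
      · simp [prior, hc]
      · symm
        apply Finset.sum_subset_zero_on_sdiff
        · rintro ⟨i, j⟩ h
          simp only [Finset.mem_filter, Finset.mem_product, Finset.mem_range] at h
          have := move_eq_target_iff (g := g) ha h.1.1 h.1.2
          simp only [Finset.mem_erase, Finset.mem_product, Finset.mem_range]
          grind
        · rintro ⟨i, j⟩ h
          simp only [Finset.mem_sdiff, Finset.mem_filter, Finset.mem_erase, Finset.mem_product,
            Finset.mem_range] at h
          have := move_eq_target_iff (g := g) ha h.1.2.1 h.1.2.2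
          have : A.get i j = 0 := by grind
          dsimp only; rw [this, hF]
        · intros; rfl
    · rw [prior, if_neg hc, hF, zero_add]
      symm
      apply Finset.sum_subset_zero_on_sdiff
      · exact Finset.filter_subset _ _
      · rintro ⟨i, j⟩ h
        simp only [Finset.mem_sdiff, Finset.mem_filter, Finset.mem_product,
            Finset.mem_range] at h
        have := move_eq_target_iff (g := g) ha h.1.1 h.1.2
        have : A.get i j = 0 := by grind
        dsimp only; rw [this, hF]
      · intros; rfl
  rw [e1, e2]
  abel

theorem total_eq_entrySum (A : SqMat ℕ) : A.total = entrySum id A := by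
  unfold total entrySum
  rw [Finset.sum_product, Finset.sum_range]
  refine Finset.sum_congr rfl fun i _ => ?_
  rw [Finset.sum_range]
  exact Finset.sum_congr rfl fun j _ => (get_coe A i j).symm

end Step

end SqMat

/-! ### Addition and removal of integers as mutually inverse steps -/

namespace SqMat

theorem zero_mat_reg (A : SqMat ℕ) (h : A.dim = 0) : A.Reg :=
  ⟨fun _ _ _ => get_of_not A (by omega), fun _ _ => by omega, fun _ _ => by omega⟩

theorem mem_intMatrices {A : SqMat ℕ} {n : ℕ} : A ∈ intMatrices n ↔ A.Reg ∧ A.total = n := by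
  rw [reg_iff]
  simp only [intMatrices, Set.mem_ofPred_eq, and_assoc]

/-- The addition step on matrices of integers. -/
def intStep (A : SqMat ℕ) (a : ℕ) : SqMat ℕ := A.gstep a (· + 1)

variable {A : SqMat ℕ} {a : ℕ}

theorem reg_intStep (hA : A.Reg) (ha : a ≤ A.dim) : (A.intStep a).Reg :=
  reg_gstep hA ha (by simp)

theorem index_intStep (ha : a ≤ A.dim) : (A.intStep a).index = a :=
  index_gstep ha (by simp)

theorem total_intStep (hA : A.Reg) (ha : a ≤ A.dim) : (A.intStep a).total = A.total + 1 := by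
  have := entrySum_gstep (g := (· + 1)) (F := id) rfl hA ha
  rw [← total_eq_entrySum, ← total_eq_entrySum] at this
  simp only [id] at this
  unfold intStep
  omega

theorem remove_eq (A : SqMat ℕ) : A.remove =
    if 1 < ∑ j ∈ Finset.range A.dim, A.get A.index j then
      ofFun A.dim fun i j => if i = A.index ∧ j = A.dim - 1 then A.get i j - 1 else A.get i j
    else if A.index = A.dim - 1 then ofFun (A.dim - 1) A.get
    else ofFun (A.dim - 1) fun i j => if i < A.index ∧ j + 1 = A.dim - 1 then A.get i A.index
      else A.get (if i < A.index then i else i + 1) (if j < A.index then j else j + 1) := rfl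

/-- The index is `a` after the step, so removal looks at the right row, and the sum of this row
tells the branches apart: it exceeds `1` if the row existed before, and is `1` if the row is new. -/
theorem remove_intStep (hA : A.Reg) (ha : a ≤ A.dim) : (A.intStep a).remove = A := by
  have hp := index_intStep ha
  rw [remove_eq, hp]
  unfold intStep at *
  rcases cases_step A ha with ⟨h1, h2⟩ | ⟨h1, h2⟩ | h1
  · obtain ⟨hd, h⟩ := gstep_le A (· + 1) h1 h2
    have hs : 1 < ∑ j ∈ Finset.range A.dim, (A.gstep a (· + 1)).get a j := by
      obtain ⟨j, hj⟩ := hA.row a h1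
      have hj' := (lt_of_get_ne A hj).2
      calc 1 ≤ A.get a j := by omega
        _ ≤ ∑ j ∈ Finset.range A.dim, A.get a j :=
          Finset.single_le_sum (f := fun j => A.get a j) (fun _ _ => Nat.zero_le _) (by simpa using hj')
        _ < _ := Finset.sum_lt_sum (fun i _ => by rw [h]; split_ifs <;> omega)
          ⟨A.dim - 1, by simp; omega, by rw [h]; simp⟩
    rw [hd, if_pos hs]
    refine ext_get rfl fun i j hi hj => ?_
    rw [get_ofFun, if_pos ⟨hi, hj⟩, h]
    split_ifs <;> omega
  · obtain ⟨hd, h⟩ := gstep_mid A (· + 1) h1 h2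
    have hs : ∑ j ∈ Finset.range (A.dim + 1), (A.gstep a (· + 1)).get a j = 1 := by
      rw [Finset.sum_eq_single_of_mem A.dim (by simp) (fun j _ hj => by rw [h]; simp [hj]), h]
      simp
    rw [hd, hs, if_neg (by omega), if_neg (by omega)]
    refine ext_get (by simp) fun i j hi hj => ?_
    rw [get_ofFun, if_pos ⟨hi, hj⟩]
    simp only [h]
    simp only [dim_ofFun, add_tsub_cancel_right] at hi hj ⊢
    have := hA.tri i j
    grind
  · obtain ⟨hd, h⟩ := gstep_ge A (· + 1) h1.ge
    have hs : ∑ j ∈ Finset.range (A.dim + 1), (A.gstep a (· + 1)).get a j = 1 := by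
      rw [Finset.sum_eq_single_of_mem A.dim (by simp)
        (fun j _ hj => by rw [h, if_neg (by omega), get_of_not A (by omega)]), h, h1]
      simp
    rw [hd, hs, if_neg (by omega), if_pos (by omega)]
    refine ext_get (by simp) fun i j hi hj => ?_
    rw [get_ofFun, if_pos ⟨hi, hj⟩, h, if_neg]
    simp only [dim_ofFun, add_tsub_cancel_right] at hi
    omega

theorem dim_pos_of_total_pos (h : A.total ≠ 0) : 0 < A.dim := by
  by_contra h0
  apply h
  rw [total_eq_entrySum, entrySum, show A.dim = 0 by omega]
  rfl

theorem row_index_of_sum_le (hA : A.Reg) (hd : 0 < A.dim)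
    (hs : ¬ 1 < ∑ j ∈ Finset.range A.dim, A.get A.index j) (j : ℕ) :
    A.get A.index j = if j = A.dim - 1 then 1 else 0 := by
  have h1 := hA.get_index hd
  rw [← Finset.add_sum_erase _ _ (show A.dim - 1 ∈ Finset.range A.dim by simp; omega)] at hs
  split_ifs with hj
  · subst hj; omega
  · by_contra h
    have hj' := (lt_of_get_ne A h).2
    have := Finset.single_le_sum (f := fun j => A.get A.index j) (fun _ _ => Nat.zero_le _)
      (show j ∈ (Finset.range A.dim).erase (A.dim - 1) by simp [hj, hj'])
    omega

/-- Each case of the removal corresponds to one case of the addition; besides regularity, it must be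
checked that the index of the smaller matrix selects that case. -/
theorem remove_spec (hA : A.Reg) (hd : 0 < A.dim) :
    A.remove.Reg ∧ A.index ≤ A.remove.dim ∧ A.remove.intStep A.index = A := by
  have hp := hA.index_lt hd
  have hpl := hA.get_index hd
  have hc := hA.corner hd
  by_cases hs : 1 < ∑ j ∈ Finset.range A.dim, A.get A.index j
  · have hr : A.remove.dim = A.dim := by rw [remove_eq, if_pos hs]; rfl
    have hg : ∀ i j, A.remove.get i j =
        if i = A.index ∧ j = A.dim - 1 then A.get i j - 1 else A.get i j := by
      intro i j
      rw [remove_eq, if_pos hs, get_ofFun]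
      have := @get_of_not _ _ A i j
      grind
    have hrow : ∃ j, A.remove.get A.index j ≠ 0 := by
      by_contra! h
      have : ∑ j ∈ Finset.range A.dim, A.get A.index j = A.get A.index (A.dim - 1) := by
        apply Finset.sum_eq_single_of_mem _ (by simp; omega)
        intro j _ hj
        have := h j
        rw [hg] at this; grind
      have := h (A.dim - 1)
      rw [hg] at this; grind
    -- If the decreased entry is the corner, what remains of its row can only be the corner itself;
    -- otherwise the corner is untouched.
    have hcol : ∃ i, A.remove.get i (A.dim - 1) ≠ 0 := by
      by_cases hi : A.index = A.dim - 1
      · obtain ⟨j, hj⟩ := hrow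
        refine ⟨A.index, ?_⟩
        have h1 : A.get A.index j ≠ 0 := by rw [hg] at hj; grind
        have := hA.le_of_get_ne h1
        have := lt_of_get_ne A h1
        rwa [show j = A.dim - 1 by omega] at hj
      · exact ⟨A.dim - 1, by rw [hg, if_neg (by omega)]; exact hc⟩
    have hreg : A.remove.Reg := by
      refine ⟨fun i j hij => ?_, fun i hi => ?_, fun j hj => ?_⟩
      · rw [hg, hA.tri i j hij]; simp
      · by_cases h : i = A.index
        · rwa [h]
        · obtain ⟨j, hj⟩ := hA.row i (hr ▸ hi)
          exact ⟨j, by rwa [hg, if_neg (by tauto)]⟩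
      · by_cases h : j = A.dim - 1
        · rwa [h]
        · obtain ⟨i, hi⟩ := hA.col j (hr ▸ hj)
          exact ⟨i, by rwa [hg, if_neg (by tauto)]⟩
    have hidx : A.index ≤ A.remove.index := by
      by_contra! h
      have h1 := hreg.get_index (by omega)
      rw [hg, hr, if_neg (by omega)] at h1
      exact h1 (get_of_lt_index h)
    refine ⟨hreg, by omega, ?_⟩
    obtain ⟨hd', h'⟩ := gstep_le A.remove (· + 1) (hr ▸ hp) hidx
    refine ext_get (hd'.trans hr) fun i j _ _ => ?_
    unfold intStep
    rw [h', hg, hr]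
    grind
  have hrow := row_index_of_sum_le hA hd hs
  by_cases hl : A.index = A.dim - 1
  · have hr : A.remove.dim = A.dim - 1 := by rw [remove_eq, if_neg hs, if_pos hl]; rfl
    have hg : ∀ i j, A.remove.get i j = if i < A.dim - 1 ∧ j < A.dim - 1 then A.get i j else 0 := by
      intro i j
      rw [remove_eq, if_neg hs, if_pos hl, get_ofFun]
    have hlast : ∀ i, i ≠ A.dim - 1 → A.get i (A.dim - 1) = 0 := by
      intro i hi
      by_contra h
      have := lt_of_get_ne A h
      exact h (get_of_lt_index (by omega))
    have hreg : A.remove.Reg := by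
      refine ⟨fun i j hij => ?_, fun i hi => ?_, fun j hj => ?_⟩
      · rw [hg, hA.tri i j hij]; simp
      · obtain ⟨j, hj⟩ := hA.row i (by omega)
        have := lt_of_get_ne A hj
        have := hlast i
        refine ⟨j, ?_⟩
        rw [hg]; grind
      · obtain ⟨i, hi⟩ := hA.col j (by omega)
        have := hA.le_of_get_ne hi
        refine ⟨i, ?_⟩
        rw [hg, if_pos (by omega)]; exact hi
    refine ⟨hreg, by omega, ?_⟩
    obtain ⟨hd', h'⟩ := gstep_ge A.remove (a := A.index) (· + 1) (by omega)
    refine ext_get (by unfold intStep; omega) fun i j hi hj => ?_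
    unfold intStep at *
    rw [h', hg, hr]
    have := hrow j
    have := hlast i
    grind
  · have hr : A.remove.dim = A.dim - 1 := by rw [remove_eq, if_neg hs, if_neg hl]; rfl
    have hg : ∀ i j, A.remove.get i j = if i < A.dim - 1 ∧ j < A.dim - 1 then
        (if i < A.index ∧ j + 1 = A.dim - 1 then A.get i A.index
        else A.get (if i < A.index then i else i + 1) (if j < A.index then j else j + 1))
        else 0 := by
      intro i j
      rw [remove_eq, if_neg hs, if_neg hl, get_ofFun]
    have hlast : ∀ i, i < A.index → A.get i (A.dim - 1) = 0 := fun i => get_of_lt_index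
    -- Column `A.index` will supply the top of the new last column. It has an entry strictly above
    -- the diagonal, because the only entry of row `A.index` is the `1` in the last column. This
    -- entry keeps the new last column non-zero and puts the new index below the old one.
    obtain ⟨r, hr0⟩ := hA.col A.index hp
    have hrle := hA.le_of_get_ne hr0
    have hrlt : r < A.index := by
      rcases hrle.eq_or_lt with h | h
      · rw [h, hrow] at hr0; simp at hr0; omega
      · exact h
    have hreg : A.remove.Reg := by
      refine ⟨fun i j hij => ?_, fun i hi => ?_, fun j hj => ?_⟩
      · rw [hg]
        have := hA.tri (if i < A.index then i else i + 1) (if j < A.index then j else j + 1)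
        grind
      · obtain ⟨j, hj⟩ := hA.row (if i < A.index then i else i + 1) (by grind)
        have h1 := lt_of_get_ne A hj
        have h2 := hA.le_of_get_ne hj
        by_cases hc1 : i < A.index
        · have := hlast i hc1
          rw [if_pos hc1] at *
          by_cases hj2 : j = A.index
          -- An entry of the deleted column above row `A.index` ends up in the last column of the
          -- smaller matrix, which has number `A.dim - 2`.
          · refine ⟨A.dim - 2, ?_⟩
            rw [hg]; grind
          · by_cases hj3 : (if j < A.index then j else j - 1) + 1 = A.dim - 1
            · grind
            · refine ⟨if j < A.index then j else j - 1, ?_⟩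
              rw [hg]; grind
        · refine ⟨j - 1, ?_⟩
          rw [hg]; grind
      · rw [hr] at hj
        by_cases hj2 : j + 1 = A.dim - 1
        · refine ⟨r, ?_⟩
          rw [hg]; grind
        · obtain ⟨i, hi⟩ := hA.col (if j < A.index then j else j + 1) (by grind)
          have h1 := lt_of_get_ne A hi
          have h2 := hA.le_of_get_ne hi
          have h3 := hrow (if j < A.index then j else j + 1)
          refine ⟨if i < A.index then i else i - 1, ?_⟩
          rw [hg]; grind
    have hidx : A.remove.index < A.index := by
      by_contra! h
      have h1 : A.remove.get r (A.remove.dim - 1) ≠ 0 := by rw [hg, hr]; grind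
      exact h1 (get_of_lt_index (by omega))
    refine ⟨hreg, by omega, ?_⟩
    obtain ⟨hd', h'⟩ := gstep_mid A.remove (a := A.index) (· + 1) (by omega) hidx
    refine ext_get (by unfold intStep; omega) fun i j hi hj => ?_
    unfold intStep at *
    rw [h']
    simp only [hg, hr]
    have := hrow j
    have := hlast i
    have := hA.tri i j
    grind

end SqMat

/-! ### Appending a term to an ascent sequence -/

namespace AscentSeq

/-- The upper bound for the next term of an ascent sequence. -/
def bound (w : List ℕ) : ℕ := if w = [] then 0 else 1 + asc w

theorem asc_append (w : List ℕ) (b a : ℕ) :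
    asc (w ++ [b] ++ [a]) = asc (w ++ [b]) + if b < a then 1 else 0 := by
  induction w with
  | nil => simp [asc, List.countP_cons]
  | cons c w ih =>
    cases w with
    | nil => simp [asc, List.countP_cons]; omega
    | cons d w =>
      have h : ∀ l, asc (c :: d :: l) = asc (d :: l) + if c < d then 1 else 0 := by
        intro l; simp [asc, List.countP_cons]
      simp only [List.cons_append] at ih ⊢
      rw [h, h, ih]
      omega

theorem bound_append (w : List ℕ) (b a : ℕ) :
    bound (w ++ [b] ++ [a]) = bound (w ++ [b]) + if b < a then 1 else 0 := by
  simp only [bound, asc_append]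
  simp
  omega

theorem append_mem_ascents {w : List ℕ} {a n : ℕ} :
    w ++ [a] ∈ ascents (n + 1) ↔ w ∈ ascents n ∧ a ≤ bound w := by
  unfold ascents bound
  simp only [Set.mem_ofPred_eq, List.length_append, List.length_singleton]
  by_cases hw : w = []
  · subst hw
    simp
    constructor
    · rintro ⟨h1, h2, -⟩; exact ⟨h1.symm, h2⟩
    · rintro ⟨h1, h2⟩; exact ⟨h1.symm, h2, by omega⟩
  · have hpos : 0 < w.length := List.length_pos_iff.2 hw
    simp only [hw, if_false]
    constructor
    · rintro ⟨h1, h2, h3⟩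
      refine ⟨⟨by omega, fun _ => ?_, fun i hi hl => ?_⟩, ?_⟩
      · have := h2 (by omega)
        rwa [List.getElem_append_left hpos] at this
      · have := h3 i hi (by omega)
        rwa [List.getElem_append_left hl, List.take_append_of_le_length hl.le] at this
      · have := h3 w.length hpos (by omega)
        simpa using this
    · rintro ⟨⟨h1, h2, h3⟩, h4⟩
      refine ⟨by omega, fun _ => ?_, fun i hi hl => ?_⟩
      · rw [List.getElem_append_left hpos]; exact h2 hpos
      · rcases Nat.lt_succ_iff_lt_or_eq.1 hl with h | h
        · rw [List.getElem_append_left h, List.take_append_of_le_length h.le]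
          exact h3 i hi h
        · subst h; simpa using h4

theorem nil_mem_ascents {n : ℕ} : [] ∈ ascents n ↔ n = 0 := by
  simp [ascents, eq_comm]

theorem mem_ascents_zero {w : List ℕ} : w ∈ ascents 0 ↔ w = [] := by
  constructor
  · rintro ⟨h, -⟩; exact List.length_eq_zero_iff.1 h
  · rintro rfl; exact nil_mem_ascents.2 rfl

theorem rlr_append_of_ne {w : List ℕ} {a : ℕ} (h : ∀ x ∈ w.getLast?, x ≠ a) :
    rlr (w ++ [a]) = rlr w ++ [1] := by
  unfold rlr
  have h1 : [a].splitBy (fun x y => x == y) = [[a]] := List.splitBy_of_isChain (by simp) (by simp)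
  rw [List.splitBy_append_cons [] (by simpa using h), h1]
  simp

/-- A repeated term joins the last run; the decomposition of `splitBy` into runs is characterized by
`List.splitBy_eq_iff`, so it suffices to extend its last block. -/
theorem rlr_append_of_eq {w : List ℕ} {a : ℕ} (h : w.getLast? = some a) :
    ∃ L c, rlr w = L ++ [c] ∧ rlr (w ++ [a]) = L ++ [c + 1] := by
  have hw : w ≠ [] := by rintro rfl; simp at h
  have hs := List.splitBy_ne_nil (r := fun x y : ℕ => x == y).2 hw
  obtain ⟨gs, l, hl⟩ : ∃ gs l, w.splitBy (fun x y => x == y) = gs ++ [l] :=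
    ⟨_, _, (List.dropLast_append_getLast hs).symm⟩
  refine ⟨gs.map List.length, l.length, by simp [rlr, hl], ?_⟩
  obtain ⟨h1, h2, h3, h4⟩ := List.splitBy_eq_iff.1 hl
  have hln : l ≠ [] := fun h => h2 (by simp [h])
  have hlast : l.getLast hln = a := by
    rw [h1, List.flatten_append, List.getLast?_append] at h
    simp [List.getLast?_eq_getLast_of_ne_nil hln] at h
    exact h
  have : (w ++ [a]).splitBy (fun x y => x == y) = gs ++ [l ++ [a]] := by
    rw [List.splitBy_eq_iff]
    refine ⟨by simp [h1], ?_, ?_, ?_⟩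
    · simp only [List.mem_append, List.mem_singleton, not_or] at h2 ⊢
      exact ⟨h2.1, by simp⟩
    · intro m hm
      rcases List.mem_append.1 hm with hm | hm
      · exact h3 m (by simp [hm])
      · rw [List.mem_singleton.1 hm, List.isChain_append]
        refine ⟨h3 l (by simp), by simp, ?_⟩
        simp [List.getLast?_eq_getLast_of_ne_nil hln, hlast]
    · rw [List.isChain_append] at h4 ⊢
      refine ⟨h4.1, by simp, fun x hx y hy => ?_⟩
      obtain ⟨hx', hy', hh⟩ := h4.2.2 x hx l (by simp)
      obtain rfl : l ++ [a] = y := by simpa using hy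
      exact ⟨hx', by simp, by rwa [List.head_append_of_ne_nil hy']⟩
  simp [rlr, this]

end AscentSeq

/-! ### One step of `gamma` and of `build` -/

namespace SqMat

open AscentSeq

theorem gamma_eq_append {A : SqMat ℕ} {n : ℕ} (h : A.total = n + 1) (h' : A.remove.total = n) :
    A.gamma = A.remove.gamma ++ [A.index] := by
  unfold gamma
  rw [h, h']
  rfl

theorem gamma_intStep {A : SqMat ℕ} {a : ℕ} (hA : A.Reg) (ha : a ≤ A.dim) :
    (A.intStep a).gamma = A.gamma ++ [a] := by
  have h := remove_intStep hA ha
  rw [gamma_eq_append (total_intStep hA ha) (by rw [h]), h, index_intStep ha]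

theorem build_append (w : List ℕ) (a : ℕ) : build (w ++ [a]) = (build w).addStep a := by
  simp [build]

/-- The timed step has the same geometry as the integer step, so all facts about `gstep` apply to
it; at a fresh position the function sees `0` and assigns the next time. -/
theorem addStep_eq (A : SqMat (ℕ × ℕ)) (a : ℕ) : A.addStep a =
    A.gstep a fun e => if e = 0 then (1, A.nz + 1) else (e.1 + 1, e.2) := by
  simp only [addStep, gstep, if_true]

/-- A map that preserves and reflects zero keeps the index, hence the branch of the step. Reflection
is asked only on the entries of `A`, since `Prod.fst` also kills the pairs `(0, t)`. -/
theorem map_gstep {α β : Type} [Zero α] [Zero β] [DecidableEq α] [DecidableEq β] {A : SqMat α}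
    {a : ℕ} {g : α → α} {g' : β → β} (f : α → β) (h0 : f 0 = 0)
    (h : ∀ i j, f (A.get i j) = 0 → A.get i j = 0) (hg : ∀ e, f (g e) = g' (f e)) :
    (A.gstep a g).map f = (A.map f).gstep a g' := by
  have hi : (A.map f).index = A.index := index_map f h0 h
  by_cases h1 : a < A.dim
  · by_cases h2 : a ≤ A.index
    · obtain ⟨hd, hh⟩ := gstep_le A g h1 h2
      obtain ⟨hd', hh'⟩ := gstep_le (A.map f) g' h1 (hi ▸ h2)
      refine ext_get (hd.trans hd'.symm) fun i j _ _ => ?_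
      rw [get_map f h0, hh, hh', get_map f h0, dim_map]
      split_ifs <;> simp [hg]
    · obtain ⟨hd, hh⟩ := gstep_mid A g h1 (not_le.1 h2)
      obtain ⟨hd', hh'⟩ := gstep_mid (A.map f) g' h1 (hi ▸ not_le.1 h2)
      refine ext_get (hd.trans hd'.symm) fun i j _ _ => ?_
      rw [get_map f h0, hh, hh', get_map f h0, get_map f h0, dim_map]
      split_ifs <;> simp [hg, h0]
  · obtain ⟨hd, hh⟩ := gstep_ge A g (not_lt.1 h1)
    obtain ⟨hd', hh'⟩ := gstep_ge (A.map f) g' (not_lt.1 h1)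
    refine ext_get (hd.trans hd'.symm) fun i j _ _ => ?_
    rw [get_map f h0, hh, hh', get_map f h0, dim_map]
    split_ifs <;> simp [hg, h0]

theorem fst_addStep {A : SqMat (ℕ × ℕ)} {a : ℕ} (h : ∀ i j, (A.get i j).1 = 0 → A.get i j = 0) :
    (A.addStep a).map Prod.fst = (A.map Prod.fst).intStep a := by
  rw [addStep_eq]
  refine map_gstep Prod.fst rfl h fun e => ?_
  split_ifs with h <;> simp [h]

end SqMat

/-! ### Times of creation versus runs, and the bijection `gamma` -/

namespace SqMat

open AscentSeq

/-- The properties of the matrix of values and times of creation built from a sequence `w`: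
the times number the non-zero entries, and the values are given by the run-length record. -/
structure Records (w : List ℕ) (T : SqMat (ℕ × ℕ)) : Prop where
  reg : T.Reg
  dim_eq : T.dim = bound w
  index_eq : ∀ x ∈ w.getLast?, T.index = x
  pos : ∀ i j, T.get i j ≠ 0 → 0 < (T.get i j).1 ∧ 0 < (T.get i j).2
  val : ∀ i j, T.get i j ≠ 0 → (rlr w)[(T.get i j).2 - 1]? = some (T.get i j).1
  inj : ∀ i j i' j', T.get i j ≠ 0 → T.get i' j' ≠ 0 → (T.get i j).2 = (T.get i' j').2 →
    i = i' ∧ j = j'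
  surj : ∀ t < (rlr w).length, ∃ i j, (T.get i j).2 = t + 1
  last : w ≠ [] → (T.get T.index (T.dim - 1)).2 = (rlr w).length

theorem nz_eq_card {α : Type} [Zero α] [DecidableEq α] (A : SqMat α) :
    A.nz = ((Finset.range A.dim ×ˢ Finset.range A.dim).filter
      fun p => A.get p.1 p.2 ≠ 0).card := by
  unfold nz
  apply Finset.card_bij (fun p _ => ((p.1 : ℕ), (p.2 : ℕ)))
  · intro p hp
    simpa [get_coe] using hp
  · intro p _ q _ h
    simpa [Prod.ext_iff, Fin.ext_iff] using h
  · rintro ⟨i, j⟩ h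
    simp only [Finset.mem_filter, Finset.mem_product, Finset.mem_range] at h
    refine ⟨(⟨i, h.1.1⟩, ⟨j, h.1.2⟩), ?_, rfl⟩
    simpa [get_of_lt A h.1.1 h.1.2] using h.2

theorem Records.le {w : List ℕ} {T : SqMat (ℕ × ℕ)} (h : Records w T) {i j : ℕ}
    (hij : T.get i j ≠ 0) : (T.get i j).2 ≤ (rlr w).length := by
  have := h.val i j hij
  have h1 := (List.getElem?_eq_some_iff.1 this).1
  have := h.pos i j hij
  omega

theorem Records.nz_eq {w : List ℕ} {T : SqMat (ℕ × ℕ)} (h : Records w T) :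
    T.nz = (rlr w).length := by
  rw [nz_eq_card, ← Finset.card_range (rlr w).length]
  apply Finset.card_bij (fun p _ => (T.get p.1 p.2).2 - 1)
  · rintro ⟨i, j⟩ hp
    have hp := (Finset.mem_filter.1 hp).2
    have := h.le hp
    have := (h.pos i j hp).2
    dsimp only at *
    rw [Finset.mem_range]
    omega
  · rintro ⟨i, j⟩ hp ⟨i', j'⟩ hp' he
    have hp := (Finset.mem_filter.1 hp).2
    have hp' := (Finset.mem_filter.1 hp').2
    have h1 := (h.pos i j hp).2
    have h2 := (h.pos i' j' hp').2
    dsimp only at he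
    obtain ⟨rfl, rfl⟩ := h.inj i j i' j' hp hp' (by omega)
    rfl
  · intro t ht
    obtain ⟨i, j, hij⟩ := h.surj t (by simpa using ht)
    have h0 : T.get i j ≠ 0 := by intro h0; rw [h0] at hij; simp at hij
    refine ⟨(i, j), ?_, by simp [hij]⟩
    simp only [Finset.mem_filter, Finset.mem_product, Finset.mem_range]
    exact ⟨lt_of_get_ne T h0, h0⟩

theorem Records.dim_pos_iff {w : List ℕ} {T : SqMat (ℕ × ℕ)} (h : Records w T) :
    0 < T.dim ↔ w ≠ [] := by
  rw [h.dim_eq, bound]; split_ifs with h <;> simp [h]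

/-- The index always equals the last term, so meeting a non-zero entry means continuing the current
run. This is the link between entries and runs. -/
theorem Records.prior_eq_zero_iff {w : List ℕ} {T : SqMat (ℕ × ℕ)} (h : Records w T) {a : ℕ} :
    T.prior a = 0 ↔ w.getLast? ≠ some a := by
  rw [SqMat.prior_eq_zero_iff h.reg, h.dim_pos_iff]
  rcases List.eq_nil_or_concat w with rfl | ⟨w, b, rfl⟩
  · simp
  · have := h.index_eq b (by simp)
    rw [this]
    simp
    exact ⟨Ne.symm, Ne.symm⟩

theorem records_nil : Records [] (build []) := by
  have hd : (build []).dim = 0 := rfl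
  have hz : ∀ i j, (build []).get i j = 0 := fun i j => get_of_not _ (by omega)
  refine ⟨⟨fun _ _ _ => hz _ _, by omega, by omega⟩, by simp [bound, hd], by simp, ?_, ?_, ?_, ?_,
    by simp⟩
  · intro i j h; exact absurd (hz i j) h
  · intro i j h; exact absurd (hz i j) h
  · intro i j _ _ h; exact absurd (hz i j) h
  · intro t ht; simp [rlr] at ht

section

variable {w : List ℕ} {T : SqMat (ℕ × ℕ)} {a : ℕ}

theorem reg_addStep (hT : T.Reg) (ha : a ≤ T.dim) : (T.addStep a).Reg := by
  rw [addStep_eq]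
  refine reg_gstep hT ha fun e => ?_
  split_ifs <;> simp [Prod.ext_iff]

theorem index_addStep (ha : a ≤ T.dim) : (T.addStep a).index = a := by
  rw [addStep_eq]
  refine index_gstep ha fun e => ?_
  split_ifs <;> simp [Prod.ext_iff]

theorem dim_addStep (T : SqMat (ℕ × ℕ)) (a : ℕ) :
    (T.addStep a).dim = if a < T.dim ∧ a ≤ T.index then T.dim else T.dim + 1 := by
  rw [addStep_eq, dim_gstep]

theorem move_eq_target (ha : a ≤ T.dim) {i j : ℕ} (h : T.get i j ≠ 0)
    (hm : T.move a i j = (a, (T.addStep a).dim - 1)) : T.get i j = T.prior a := by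
  rw [addStep_eq, move_eq_target_iff ha (lt_of_get_ne T h).1 (lt_of_get_ne T h).2] at hm
  rw [prior, if_pos hm.1, hm.2.1, hm.2.2]

theorem Records.snd_target (hT : Records w T) (ha : a ≤ T.dim) :
    ((T.addStep a).get a ((T.addStep a).dim - 1)).2 =
      if w.getLast? = some a then (rlr w).length else (rlr w).length + 1 := by
  have := hT.prior_eq_zero_iff (a := a)
  rw [addStep_eq, get_target ha]
  by_cases h : w.getLast? = some a
  · have h0 : T.prior a ≠ 0 := fun h' => this.1 h' h
    have hw : w ≠ [] := by rintro rfl; simp at h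
    rw [if_neg h0, if_pos h]
    dsimp only
    unfold prior at *
    split_ifs at h0 ⊢
    · rw [← hT.index_eq a h, hT.last hw]
    · exact absurd rfl h0
  · rw [if_pos (this.2 h), if_neg h, hT.nz_eq]

theorem Records.snd_move (hT : Records w T) (ha : a ≤ T.dim) {i j : ℕ} (h : T.get i j ≠ 0) :
    ((T.addStep a).get (T.move a i j).1 (T.move a i j).2).2 = (T.get i j).2 := by
  by_cases hm : T.move a i j = (a, (T.addStep a).dim - 1)
  · have h1 := move_eq_target ha h hm
    rw [hm]
    dsimp only
    rw [addStep_eq, get_target ha, if_neg (h1 ▸ h), h1]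
  · rw [addStep_eq] at hm ⊢
    rw [get_move ha (lt_of_get_ne T h).1 (lt_of_get_ne T h).2 (hT.reg.le_of_get_ne h) hm]

/-- If `a` continues the last run, the entry with the largest time grows by one, as does the last
run length. Otherwise a new entry `1` gets the next time, as a new run of length `1` starts. All
other entries only move. -/
theorem Records.append (hT : Records w T) (ha : a ≤ T.dim) :
    Records (w ++ [a]) (T.addStep a) := by
  have htarget : (T.addStep a).get a ((T.addStep a).dim - 1) =
      if T.prior a = 0 then (1, (rlr w).length + 1) else ((T.prior a).1 + 1, (T.prior a).2) := by
    rw [← hT.nz_eq, addStep_eq, get_target ha]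
  have hsnd := hT.snd_target ha
  have hmove : ∀ i j, T.get i j ≠ 0 → T.move a i j ≠ (a, (T.addStep a).dim - 1) →
      (T.addStep a).get (T.move a i j).1 (T.move a i j).2 = T.get i j := by
    intro i j h hm
    rw [addStep_eq] at hm ⊢
    exact get_move ha (lt_of_get_ne T h).1 (lt_of_get_ne T h).2 (hT.reg.le_of_get_ne h) hm
  have hex : ∀ i j, (T.addStep a).get i j ≠ 0 → (i, j) = (a, (T.addStep a).dim - 1) ∨
      ∃ i' j', T.get i' j' ≠ 0 ∧ T.move a i' j' = (i, j) ∧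
        (i, j) ≠ (a, (T.addStep a).dim - 1) ∧ (T.addStep a).get i j = T.get i' j' := by
    intro i j h
    by_cases hq : (i, j) = (a, (T.addStep a).dim - 1)
    · exact Or.inl hq
    · have := hq
      rw [addStep_eq] at h hq
      rcases exists_move_eq hT.reg ha h with h1 | ⟨i', j', h1, h2⟩
      · exact absurd h1 hq
      · have h3 := hmove i' j' h1 (by rwa [h2])
        rw [h2] at h3
        exact Or.inr ⟨i', j', h1, h2, this, h3⟩
  have hprior := hT.prior_eq_zero_iff (a := a)
  -- an entry that is not changed has a different time of creation
  have hne : ∀ i j, T.get i j ≠ 0 → T.move a i j ≠ (a, (T.addStep a).dim - 1) →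
      (T.get i j).2 ≠ ((T.addStep a).get a ((T.addStep a).dim - 1)).2 ∧
      (w.getLast? = some a → (T.get i j).2 < (rlr w).length) := by
    intro i j h hm
    have hle := hT.le h
    rw [hsnd]
    split_ifs with hl
    · suffices (T.get i j).2 ≠ (rlr w).length from ⟨this, fun _ => by omega⟩
      intro he
      have hw : w ≠ [] := by rintro rfl; simp at hl
      have hd := hT.dim_pos_iff.2 hw
      have h1 := hT.reg.get_index hd
      obtain ⟨h2, h3⟩ := hT.inj _ _ _ _ h h1 (he.trans (hT.last hw).symm)
      apply hm
      have h4 := hT.index_eq a hl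
      rw [addStep_eq, move_eq_target_iff ha (lt_of_get_ne T h).1 (lt_of_get_ne T h).2]
      have := (lt_of_get_ne T h).1
      omega
    · exact ⟨by omega, fun h => absurd h hl⟩
  have hindex := index_addStep (T := T) ha
  refine ⟨reg_addStep hT.reg ha, ?_, ?_, ?_, ?_, ?_, ?_, ?_⟩
  · rw [dim_addStep]
    rcases List.eq_nil_or_concat w with rfl | ⟨w, b, rfl⟩
    · have : T.dim = 0 := by rw [hT.dim_eq]; rfl
      simp [this, bound, asc]
    · rw [List.concat_eq_append] at *
      -- The index is the preceding term `b`, so the matrix is enlarged exactly if `b < a`, which is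
      -- also when the ascent bound increases.
      have h1 := hT.index_eq b (by simp)
      have h2 := hT.reg.index_lt (hT.dim_pos_iff.2 (by simp))
      rw [bound_append, ← hT.dim_eq]
      split_ifs <;> omega
  · intro x hx
    rw [hindex]
    simpa using hx
  · intro i j h
    rcases hex i j h with h1 | ⟨i', j', h1, -, -, h2⟩
    · obtain ⟨rfl, rfl⟩ := Prod.mk.inj h1
      constructor
      · rw [htarget]; split_ifs <;> simp
      · rw [hsnd]
        split_ifs with h2
        · obtain ⟨L, c, h3, -⟩ := rlr_append_of_eq h2
          simp [h3]
        · omega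
    · rw [h2]; exact hT.pos _ _ h1
  · intro i j h
    rcases hex i j h with h1 | ⟨i', j', h1, h2, h3, h4⟩
    · obtain ⟨rfl, rfl⟩ := Prod.mk.inj h1
      rw [hsnd]
      by_cases hl : w.getLast? = some i
      · obtain ⟨L, c, h3, h4⟩ := rlr_append_of_eq hl
        have h5 : T.prior i ≠ 0 := fun h' => hprior.1 h' hl
        rw [if_pos hl, htarget, if_neg h5, h3, h4]
        have h6 : T.prior i = T.get i (T.dim - 1) := by
          unfold prior at h5 ⊢
          split_ifs at h5 ⊢
          · rfl
          · exact absurd rfl h5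
        have hw : w ≠ [] := by rintro rfl; simp at hl
        have h7 := hT.val i (T.dim - 1) (h6 ▸ h5)
        have h8 := hT.last hw
        rw [hT.index_eq i hl] at h8
        rw [h8, h3] at h7
        simp at h7
        simp [h6, h7]
      · rw [if_neg hl, rlr_append_of_ne (by rintro x hx rfl; exact hl hx), htarget,
          if_pos (hprior.2 hl)]
        simp
    · rw [h4]
      have h5 := hT.val i' j' h1
      have hlt := (List.getElem?_eq_some_iff.1 h5).1
      have h6 := (hT.pos i' j' h1).2
      by_cases hl : w.getLast? = some a
      · obtain ⟨L, c, h7, h8⟩ := rlr_append_of_eq hl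
        have := (hne i' j' h1 (by rw [h2]; exact h3)).2 hl
        rw [h7] at this h5
        rw [h8]
        simp only [List.length_append, List.length_singleton] at this
        rw [List.getElem?_append_left (by omega)] at h5 ⊢
        exact h5
      · rw [rlr_append_of_ne (by rintro x hx rfl; exact hl hx), List.getElem?_append_left hlt]
        exact h5
  · intro i j i' j' h h' he
    rcases hex i j h with h1 | ⟨i1, j1, h1, h2, h3, h4⟩ <;>
    rcases hex i' j' h' with h1' | ⟨i1', j1', h1', h2', h3', h4'⟩
    · exact Prod.ext_iff.1 (h1.trans h1'.symm)
    · exfalso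
      obtain ⟨rfl, rfl⟩ := Prod.mk.inj h1
      rw [h4'] at he
      exact (hne _ _ h1' (by rw [h2']; exact h3')).1 he.symm
    · exfalso
      obtain ⟨rfl, rfl⟩ := Prod.mk.inj h1'
      rw [h4] at he
      exact (hne _ _ h1 (by rw [h2]; exact h3)).1 he
    · rw [h4, h4'] at he
      obtain ⟨rfl, rfl⟩ := hT.inj _ _ _ _ h1 h1' he
      exact Prod.ext_iff.1 (h2.symm.trans h2')
  · intro t ht
    have key : ∀ s < (rlr w).length, ∃ i j, ((T.addStep a).get i j).2 = s + 1 := by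
      intro s hs
      obtain ⟨i, j, h⟩ := hT.surj s hs
      have h0 : T.get i j ≠ 0 := by intro h0; rw [h0] at h; simp at h
      exact ⟨_, _, (hT.snd_move ha h0).trans h⟩
    by_cases hl : w.getLast? = some a
    · obtain ⟨L, c, h7, h8⟩ := rlr_append_of_eq hl
      apply key
      rw [h8] at ht
      rw [h7]
      simpa using ht
    · rw [rlr_append_of_ne (by rintro x hx rfl; exact hl hx)] at ht
      simp only [List.length_append, List.length_singleton] at ht
      by_cases h : t < (rlr w).length
      · exact key t h
      · refine ⟨_, _, hsnd.trans ?_⟩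
        rw [if_neg hl]; omega
  · intro _
    rw [hindex, hsnd]
    split_ifs with hl
    · obtain ⟨L, c, h7, h8⟩ := rlr_append_of_eq hl
      simp [h7, h8]
    · rw [rlr_append_of_ne (by rintro x hx rfl; exact hl hx)]
      simp

theorem records_build (w : List ℕ) {n : ℕ} (hw : w ∈ ascents n) : Records w (build w) := by
  induction w using List.reverseRecOn generalizing n with
  | nil => exact records_nil
  | append_singleton w a ih =>
    cases n with
    | zero => simp [mem_ascents_zero] at hw
    | succ n =>
      obtain ⟨h1, h2⟩ := append_mem_ascents.1 hw
      rw [build_append]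
      exact (ih h1).append ((ih h1).dim_eq ▸ h2)

theorem Records.fst_eq_zero (hT : Records w T) (i j : ℕ) (h : (T.get i j).1 = 0) :
    T.get i j = 0 := by
  by_contra h0
  have := (hT.pos i j h0).1
  omega

theorem Records.snd_eq_zero (hT : Records w T) (i j : ℕ) (h : (T.get i j).2 = 0) :
    T.get i j = 0 := by
  by_contra h0
  have := (hT.pos i j h0).2
  omega

end

theorem gammaInv_append {w : List ℕ} {n a : ℕ} (hw : w ∈ ascents n) :
    gammaInv (w ++ [a]) = (gammaInv w).intStep a := by
  unfold gammaInv
  rw [build_append, fst_addStep (records_build w hw).fst_eq_zero]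

/-- The dimension is carried along in the induction because it turns the ascent condition on the
next term into the admissibility `a ≤ dim` of the step. -/
theorem gammaInv_spec (w : List ℕ) {n : ℕ} (hw : w ∈ ascents n) :
    gammaInv w ∈ intMatrices n ∧ (gammaInv w).dim = bound w ∧ (gammaInv w).gamma = w := by
  induction w using List.reverseRecOn generalizing n with
  | nil =>
    obtain rfl := nil_mem_ascents.1 hw
    refine ⟨mem_intMatrices.2 ⟨zero_mat_reg _ rfl, rfl⟩, rfl, rfl⟩
  | append_singleton w a ih =>
    cases n with
    | zero => simp [mem_ascents_zero] at hw
    | succ n =>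
      have hd := (records_build _ hw).dim_eq
      obtain ⟨h1, h2⟩ := append_mem_ascents.1 hw
      obtain ⟨h3, h4, h5⟩ := ih h1
      rw [mem_intMatrices] at h3
      rw [← h4] at h2
      refine ⟨?_, hd, ?_⟩
      · rw [gammaInv_append h1, mem_intMatrices]
        exact ⟨reg_intStep h3.1 h2, by rw [total_intStep h3.1 h2, h3.2]⟩
      · rw [gammaInv_append h1, gamma_intStep h3.1 h2, h5]

/-- Induction on the total by `remove_spec`: the index is at most the dimension of the smaller
matrix, which equals the ascent bound of its sequence. -/
theorem gamma_spec {n : ℕ} {A : SqMat ℕ} (hA : A ∈ intMatrices n) :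
    A.gamma ∈ ascents n ∧ gammaInv A.gamma = A := by
  induction n generalizing A with
  | zero =>
    obtain ⟨h1, h2⟩ := mem_intMatrices.1 hA
    have hg : A.gamma = [] := by rw [gamma, h2]; rfl
    rw [hg]
    refine ⟨nil_mem_ascents.2 rfl, ?_⟩
    have hd : A.dim = 0 := by
      by_contra h
      have h3 := h1.corner (Nat.pos_of_ne_zero h)
      have h4 := lt_of_get_ne A h3
      apply h3
      rw [total_eq_entrySum, entrySum, Finset.sum_eq_zero_iff] at h2
      exact h2 (A.dim - 1, A.dim - 1) (by simpa using h4)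
    exact ext_get hd.symm fun i j hi _ => absurd hi (Nat.not_lt_zero i)
  | succ n ih =>
    obtain ⟨h1, h2⟩ := mem_intMatrices.1 hA
    obtain ⟨h3, h4, h5⟩ := remove_spec h1 (dim_pos_of_total_pos (by omega))
    have h6 : A.remove.total = n := by
      have := total_intStep h3 h4
      rw [h5] at this
      omega
    obtain ⟨h7, h8⟩ := ih (mem_intMatrices.2 ⟨h3, h6⟩)
    rw [gamma_eq_append h2 h6]
    have hdim := (gammaInv_spec _ h7).2.1
    rw [h8] at hdim
    refine ⟨append_mem_ascents.2 ⟨h7, hdim ▸ h4⟩, ?_⟩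
    rw [gammaInv_append h7, h8, h5]

end SqMat

/-! ### Composition matrices and the maps `phi` and `psi` -/

namespace SqMat

open AscentSeq

/-- The empty set as the zero entry of matrices of sets. -/
abbrev finsetZero : Zero (Finset ℕ) := ⟨∅⟩

attribute [local instance] finsetZero

theorem finset_zero_eq : (0 : Finset ℕ) = ∅ := rfl

theorem Reg.map {α β : Type} [Zero α] [Zero β] {A : SqMat α} (hA : A.Reg) (f : α → β)
    (h0 : f 0 = 0) (h : ∀ i j, f (A.get i j) = 0 → A.get i j = 0) : (A.map f).Reg := by
  refine ⟨fun i j hij => ?_, fun i hi => ?_, fun j hj => ?_⟩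
  · rw [get_map f h0, hA.tri i j hij, h0]
  · obtain ⟨j, hj⟩ := hA.row i hi
    exact ⟨j, by rw [get_map f h0]; exact mt (h i j) hj⟩
  · obtain ⟨i, hi⟩ := hA.col j hj
    exact ⟨i, by rw [get_map f h0]; exact mt (h i j) hi⟩

theorem get_card (A : SqMat (Finset ℕ)) (i j : ℕ) : A.card.get i j = (A.get i j).card :=
  get_map Finset.card rfl A i j

theorem reg_card {A : SqMat (Finset ℕ)} (hA : A.Reg) : A.card.Reg :=
  hA.map Finset.card rfl fun _ _ h => Finset.card_eq_zero.1 h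

theorem mem_get_iff {A : SqMat (Finset ℕ)} {x : ℕ} :
    (∃ i j, x ∈ A.get i j) ↔ ∃ i j, x ∈ A.entry i j := by
  constructor
  · rintro ⟨i, j, h⟩
    have h0 : A.get i j ≠ 0 := by rw [finset_zero_eq]; rintro h'; simp [h'] at h
    obtain ⟨hi, hj⟩ := lt_of_get_ne A h0
    rw [get_of_lt A hi hj] at h
    exact ⟨_, _, h⟩
  · rintro ⟨i, j, h⟩
    exact ⟨i, j, by rwa [get_coe]⟩

theorem mem_compMatrices {A : SqMat (Finset ℕ)} {n : ℕ} : A ∈ compMatrices n ↔ A.Reg ∧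
    (∀ i j i' j', (i, j) ≠ (i', j') → Disjoint (A.get i j) (A.get i' j')) ∧
    (∀ x, x ∈ Finset.Icc 1 n ↔ ∃ i j, x ∈ A.get i j) := by
  rw [reg_iff]
  simp only [compMatrices, Set.mem_ofPred_eq, and_assoc, Finset.nonempty_iff_ne_empty,
    mem_get_iff, finset_zero_eq]
  refine and_congr_right fun _ => and_congr_right fun _ => and_congr_right fun _ =>
    and_congr_left fun _ => ?_
  constructor
  · intro h i j i' j' hne
    by_cases h1 : i < A.dim ∧ j < A.dim
    · by_cases h2 : i' < A.dim ∧ j' < A.dim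
      · rw [get_of_lt A h1.1 h1.2, get_of_lt A h2.1 h2.2]
        apply h
        simpa [Prod.ext_iff, Fin.ext_iff] using hne
      · rw [get_of_not A h2]; exact Finset.disjoint_empty_right _
    · rw [get_of_not A h1]; exact Finset.disjoint_empty_left _
  · intro h i j i' j' hne
    have := h i j i' j' (by simpa [Prod.ext_iff, Fin.ext_iff] using hne)
    rwa [get_coe, get_coe] at this

theorem card_mem_intMatrices {A : SqMat (Finset ℕ)} {n : ℕ} (hA : A ∈ compMatrices n) :
    A.card ∈ intMatrices n := by
  obtain ⟨h1, h2, h3⟩ := mem_compMatrices.1 hA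
  refine mem_intMatrices.2 ⟨reg_card h1, ?_⟩
  rw [total_eq_entrySum, entrySum]
  have hu : (Finset.range A.dim ×ˢ Finset.range A.dim).biUnion (fun p => A.get p.1 p.2) =
      Finset.Icc 1 n := by
    ext x
    rw [h3]
    simp only [Finset.mem_biUnion, Finset.mem_product, Finset.mem_range]
    constructor
    · rintro ⟨p, -, h⟩; exact ⟨_, _, h⟩
    · rintro ⟨i, j, h⟩
      refine ⟨(i, j), lt_of_get_ne A ?_, h⟩
      rw [finset_zero_eq]; rintro h'; simp [h'] at h
  have := congrArg Finset.card hu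
  rw [Finset.card_biUnion] at this
  · simp only [Nat.card_Icc, add_tsub_cancel_right] at this
    rw [← this]
    exact Finset.sum_congr rfl fun p _ => get_card A _ _
  · rintro p - q - hpq
    exact h2 _ _ _ _ hpq

theorem get_creationTime {w : List ℕ} {n : ℕ} (hw : w ∈ ascents n) (i j : ℕ) :
    (gammaInv w).creationTime.get i j = ((build w).get i j).2 := by
  unfold creationTime
  rw [get_ofFun, (gammaInv_spec w hw).2.2]
  split_ifs with h
  · rfl
  · rw [get_of_not]
    · rfl
    · exact h

theorem get_gammaInv (w : List ℕ) (i j : ℕ) :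
    (gammaInv w).get i j = ((build w).get i j).1 :=
  get_map Prod.fst rfl _ _ _

theorem get_psi {m : List ℕ × List (Finset ℕ)} {n : ℕ} (hm : m.1 ∈ ascents n) (i j : ℕ) :
    (psi m).get i j = if ((build m.1).get i j).2 = 0 then ∅
      else m.2.getD (((build m.1).get i j).2 - 1) ∅ := by
  unfold psi
  dsimp only
  rw [get_ofFun, get_creationTime hm]
  split_ifs with h h1 h2
  · rfl
  · rfl
  · rfl
  · exact absurd (by rw [get_of_not (build m.1) h]; rfl) h2

section

variable {A : SqMat (Finset ℕ)} {n : ℕ}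

theorem nz_gammaInv {w : List ℕ} (hw : w ∈ ascents n) : (gammaInv w).nz = (rlr w).length := by
  have hT := records_build w hw
  rw [← hT.nz_eq, nz_eq_card, nz_eq_card]
  congr 1
  ext p
  simp only [get_gammaInv, Finset.mem_filter]
  exact and_congr Iff.rfl (not_congr ⟨hT.fst_eq_zero _ _, fun h => by rw [h]; rfl⟩)

/-- Times of creation are injective on non-zero entries, so the union in `setSystem` runs over a
single position. -/
theorem getElem?_setSystem {w : List ℕ} (hw : w ∈ ascents n) (hA : A.card = gammaInv w)
    {i j s : ℕ} (hs : ((build w).get i j).2 = s + 1) :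
    A.setSystem[s]? = some (A.get i j) := by
  have hT := records_build w hw
  have h0 : (build w).get i j ≠ 0 := by intro h; rw [h] at hs; simp at hs
  have hnz := nz_gammaInv hw
  have hle := hT.le h0
  unfold setSystem
  rw [show A.card.nz = (rlr w).length by rw [hA, hnz], List.getElem?_map, List.getElem?_range (by omega)]
  simp only [Option.map_some, Option.some.injEq]
  have hd : A.dim = (build w).dim := congrArg SqMat.dim hA
  obtain ⟨hi, hj⟩ := lt_of_get_ne _ h0
  rw [← hd] at hi hj
  rw [get_of_lt A hi hj, hA]
  have : (Finset.univ.filter fun p : Fin A.dim × Fin A.dim =>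
      (gammaInv w).creationTime.get p.1 p.2 = s + 1) = {(⟨i, hi⟩, ⟨j, hj⟩)} := by
    ext ⟨i', j'⟩
    simp only [get_creationTime hw, Finset.mem_filter, Finset.mem_univ, true_and,
      Finset.mem_singleton, Prod.mk.injEq, Fin.ext_iff]
    constructor
    · intro h
      have h1 : (build w).get i' j' ≠ 0 := by intro h2; rw [h2] at h; simp at h
      exact hT.inj _ _ _ _ h1 h0 (h.trans hs.symm)
    · rintro ⟨rfl, rfl⟩
      exact hs
  rw [this, Finset.singleton_biUnion]

theorem length_setSystem {w : List ℕ} (hw : w ∈ ascents n) (hA : A.card = gammaInv w) :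
    A.setSystem.length = (rlr w).length := by
  rw [setSystem, List.length_map, List.length_range, hA, nz_gammaInv hw]

theorem exists_of_lt_setSystem {w : List ℕ} (hw : w ∈ ascents n) (hA : A.card = gammaInv w)
    {s : ℕ} (hs : s < A.setSystem.length) :
    ∃ i j, ((build w).get i j).2 = s + 1 ∧ A.setSystem[s] = A.get i j := by
  rw [length_setSystem hw hA] at hs
  obtain ⟨i, j, h⟩ := (records_build w hw).surj s hs
  exact ⟨i, j, h, (List.getElem?_eq_some_iff.1 (getElem?_setSystem hw hA h)).2⟩

theorem phi_mem_mad (hA : A ∈ compMatrices n) : phi A ∈ mad n := by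
  obtain ⟨hw, hg⟩ := gamma_spec (card_mem_intMatrices hA)
  obtain ⟨h1, h2, h3⟩ := mem_compMatrices.1 hA
  have hT := records_build _ hw
  have hcard : ∀ i j, (A.get i j).card = ((build A.card.gamma).get i j).1 := by
    intro i j
    rw [← get_card, ← get_gammaInv, hg]
  refine ⟨hw, ?_, ?_, ?_, ?_⟩
  · intro X hX
    obtain ⟨s, hs, rfl⟩ := List.mem_iff_getElem.1 hX
    obtain ⟨i, j, h4, h5⟩ := exists_of_lt_setSystem hw hg.symm hs
    change (A.setSystem[s]).Nonempty
    have h0 : (build A.card.gamma).get i j ≠ 0 := by intro h; rw [h] at h4; simp at h4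
    rw [h5, ← Finset.card_pos, hcard]
    exact (hT.pos i j h0).1
  · rw [List.pairwise_iff_getElem]
    intro s t hs ht hst
    obtain ⟨i, j, h4, h5⟩ := exists_of_lt_setSystem hw hg.symm hs
    obtain ⟨i', j', h4', h5'⟩ := exists_of_lt_setSystem hw hg.symm ht
    change Disjoint A.setSystem[s] A.setSystem[t]
    rw [h5, h5']
    apply h2
    intro h
    obtain ⟨rfl, rfl⟩ := Prod.mk.inj h
    omega
  · intro x
    rw [h3]
    constructor
    · rintro ⟨i, j, hx⟩
      have h5 : 0 < (A.get i j).card := Finset.card_pos.2 ⟨x, hx⟩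
      rw [hcard] at h5
      have h0 : (build A.card.gamma).get i j ≠ 0 := by intro h; rw [h] at h5; simp at h5
      have h6 := (hT.pos i j h0).2
      have := getElem?_setSystem hw hg.symm (s := ((build A.card.gamma).get i j).2 - 1)
        (i := i) (j := j) (by omega)
      exact ⟨_, List.mem_of_getElem? this, hx⟩
    · rintro ⟨X, hX, hx⟩
      obtain ⟨s, hs, rfl⟩ := List.mem_iff_getElem.1 hX
      obtain ⟨i, j, h4, h5⟩ := exists_of_lt_setSystem hw hg.symm hs
      change x ∈ A.setSystem[s] at hx
      exact ⟨i, j, h5 ▸ hx⟩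
  · have hl := length_setSystem hw hg.symm
    change A.setSystem.map Finset.card = rlr A.card.gamma
    refine List.ext_getElem (by simpa using hl) fun s hs hs' => ?_
    obtain ⟨i, j, h4, h5⟩ := exists_of_lt_setSystem hw hg.symm (by simpa using hs)
    have h0 : (build A.card.gamma).get i j ≠ 0 := by intro h; rw [h] at h4; simp at h4
    have h6 := hT.val i j h0
    rw [List.getElem_map, h5, hcard]
    rw [h4, Nat.add_sub_cancel, List.getElem?_eq_getElem hs'] at h6
    exact (Option.some.inj h6).symm

theorem psi_phi (hA : A ∈ compMatrices n) : psi (phi A) = A := by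
  obtain ⟨hw, hg⟩ := gamma_spec (card_mem_intMatrices hA)
  have hT := records_build _ hw
  have hd : (psi (phi A)).dim = A.dim := by
    have h := congrArg SqMat.dim hg
    exact h
  refine ext_get hd fun i j _ _ => ?_
  rw [get_psi hw]
  change (if ((build A.card.gamma).get i j).2 = 0 then ∅
      else A.setSystem.getD (((build A.card.gamma).get i j).2 - 1) ∅) = _
  split_ifs with h
  -- Time `0` means that the cardinality is `0`, so the entry is empty, as is `X_0`.
  · have h1 := get_card A i j
    rw [← hg, get_gammaInv, hT.snd_eq_zero i j h] at h1
    exact (Finset.card_eq_zero.1 h1.symm).symm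
  · rw [List.getD_eq_getElem?_getD, getElem?_setSystem hw hg.symm (i := i) (j := j) (by omega)]
    rfl

theorem psi_spec {m : List ℕ × List (Finset ℕ)} (hm : m ∈ mad n) :
    psi m ∈ compMatrices n ∧ phi (psi m) = m := by
  obtain ⟨hw, h1, h2, h3, h4⟩ := hm
  have hT := records_build _ hw
  have hlen : m.2.length = (rlr m.1).length := by rw [← h4, List.length_map]
  have hget : ∀ i j, (build m.1).get i j ≠ 0 →
      ∃ h : ((build m.1).get i j).2 - 1 < m.2.length,
        (psi m).get i j = m.2[((build m.1).get i j).2 - 1] := by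
    intro i j h
    have h5 := (hT.pos i j h).2
    have h6 := hT.le h
    have h7 : ((build m.1).get i j).2 - 1 < m.2.length := by omega
    refine ⟨h7, ?_⟩
    rw [get_psi hw, if_neg (by omega), List.getD_eq_getElem?_getD, List.getElem?_eq_getElem h7]
    rfl
  have hzero : ∀ i j, (build m.1).get i j = 0 → (psi m).get i j = ∅ := by
    intro i j h
    rw [get_psi hw, if_pos (by rw [h]; rfl)]
  have hne : ∀ i j, (build m.1).get i j ≠ 0 → (psi m).get i j ≠ ∅ := by
    intro i j h
    obtain ⟨h5, h6⟩ := hget i j h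
    rw [h6]
    exact (h1 _ (List.getElem_mem h5)).ne_empty
  -- The block sizes are the run lengths, and these are the values of the entries with the
  -- corresponding times. With this equality, `gamma` recovers the sequence.
  have hcard : (psi m).card = gammaInv m.1 := by
    refine ext_get rfl fun i j _ _ => ?_
    rw [get_card, get_gammaInv]
    by_cases h : (build m.1).get i j = 0
    · rw [h, hzero i j h]; rfl
    · obtain ⟨h5, h6⟩ := hget i j h
      have h7 := hT.val i j h
      rw [← h4, List.getElem?_map, List.getElem?_eq_getElem h5] at h7
      rw [h6]
      exact Option.some.inj h7
  have hdisj : ∀ i j i' j', (build m.1).get i j ≠ 0 → (build m.1).get i' j' ≠ 0 →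
      ((build m.1).get i j).2 < ((build m.1).get i' j').2 →
      Disjoint ((psi m).get i j) ((psi m).get i' j') := by
    intro i j i' j' h h' hlt
    obtain ⟨h5, h6⟩ := hget i j h
    obtain ⟨h5', h6'⟩ := hget i' j' h'
    rw [h6, h6']
    have := (hT.pos i j h).2
    exact List.pairwise_iff_getElem.1 h2 _ _ h5 h5' (by omega)
  have hcomp : psi m ∈ compMatrices n := by
    refine mem_compMatrices.2 ⟨⟨fun i j hij => ?_, fun i hi => ?_, fun j hj => ?_⟩, ?_, ?_⟩
    · exact hzero i j (hT.reg.tri i j hij)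
    · obtain ⟨j, hj⟩ := hT.reg.row i hi
      exact ⟨j, hne i j hj⟩
    · obtain ⟨i, hi⟩ := hT.reg.col j hj
      exact ⟨i, hne i j hi⟩
    · intro i j i' j' hp
      by_cases h : (build m.1).get i j = 0
      · rw [hzero i j h]; exact Finset.disjoint_empty_left _
      by_cases h' : (build m.1).get i' j' = 0
      · rw [hzero i' j' h']; exact Finset.disjoint_empty_right _
      rcases lt_trichotomy ((build m.1).get i j).2 ((build m.1).get i' j').2 with hlt | he | hgt
      · exact hdisj _ _ _ _ h h' hlt
      · obtain ⟨rfl, rfl⟩ := hT.inj _ _ _ _ h h' he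
        exact absurd rfl hp
      · exact (hdisj _ _ _ _ h' h hgt).symm
    · intro x
      rw [h3]
      constructor
      · rintro ⟨X, hX, hx⟩
        obtain ⟨s, hs, rfl⟩ := List.mem_iff_getElem.1 hX
        obtain ⟨i, j, hij⟩ := hT.surj s (by omega)
        have h0 : (build m.1).get i j ≠ 0 := by intro h; rw [h] at hij; simp at hij
        obtain ⟨h5, h6⟩ := hget i j h0
        refine ⟨i, j, ?_⟩
        rw [h6]
        simpa [hij] using hx
      · rintro ⟨i, j, hx⟩
        have h0 : (build m.1).get i j ≠ 0 := by
          intro h; rw [hzero i j h] at hx; simp at hx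
        obtain ⟨h5, h6⟩ := hget i j h0
        rw [h6] at hx
        exact ⟨_, List.getElem_mem h5, hx⟩
  refine ⟨hcomp, Prod.ext ?_ ?_⟩
  · change (psi m).card.gamma = m.1
    rw [hcard, (gammaInv_spec _ hw).2.2]
  · change (psi m).setSystem = m.2
    refine List.ext_getElem ((length_setSystem hw hcard).trans hlen.symm) fun s hs hs' => ?_
    obtain ⟨i, j, h5, h6⟩ := exists_of_lt_setSystem hw hcard hs
    have h0 : (build m.1).get i j ≠ 0 := by intro h; rw [h] at h5; simp at h5
    obtain ⟨h7, h8⟩ := hget i j h0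
    rw [h6, h8]
    simp [h5]

end

end SqMat

/-! ### Interval representations and the poset construction -/

namespace LabelledPoset

/-- The order on `P` is the interval order that assigns to `x` the interval `[row x, col x]`, and
every number less than `d` is a lower end and an upper end. -/
structure Rep (P : LabelledPoset) (d : ℕ) (row col : ℕ → ℕ) : Prop where
  rel : ∀ x y, (x, y) ∈ P.rel ↔ x ∈ P.carrier ∧ y ∈ P.carrier ∧ col x < row y
  le : ∀ x ∈ P.carrier, row x ≤ col x
  lt : ∀ x ∈ P.carrier, col x < d
  row_surj : ∀ i < d, ∃ x ∈ P.carrier, row x = i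
  col_surj : ∀ j < d, ∃ x ∈ P.carrier, col x = j

namespace Rep

variable {P : LabelledPoset} {d : ℕ} {row col : ℕ → ℕ}

theorem down_eq (h : Rep P d row col) {y : ℕ} (hy : y ∈ P.carrier) :
    P.down y = P.carrier.filter fun x => col x < row y := by
  ext x
  simp only [down, Finset.mem_filter, h.rel]
  tauto

theorem ssubset_iff (h : Rep P d row col) {i j : ℕ} (hi : i < d) :
    (P.carrier.filter fun x => col x < i) ⊂ (P.carrier.filter fun x => col x < j) ↔ i < j := by
  constructor
  · intro hs
    by_contra! hij
    refine hs.2 fun x hx => ?_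
    rw [Finset.mem_filter] at hx ⊢
    exact ⟨hx.1, by omega⟩
  · intro hij
    refine ⟨fun x hx => ?_, fun hs => ?_⟩
    · rw [Finset.mem_filter] at hx ⊢
      exact ⟨hx.1, by omega⟩
    · obtain ⟨x, hx, hxi⟩ := h.col_surj i hi
      have := hs (Finset.mem_filter.2 ⟨hx, by omega⟩)
      rw [Finset.mem_filter] at this
      omega

theorem injOn (h : Rep P d row col) :
    Set.InjOn (fun i => P.carrier.filter fun x => col x < i) (Finset.range d) := by
  intro i hi j hj hij
  simp only [Finset.coe_range, Set.mem_Iio] at hi hj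
  dsimp only at hij
  have h1 := h.ssubset_iff (j := j) hi
  have h2 := h.ssubset_iff (j := i) hj
  rw [hij] at h1 h2
  by_contra hne
  rcases lt_or_gt_of_ne hne with h3 | h3
  · exact (h1.2 h3).ne rfl
  · exact (h2.2 h3).ne rfl

theorem downs_eq (h : Rep P d row col) :
    P.downs = (Finset.range d).image fun i => P.carrier.filter fun x => col x < i := by
  ext E
  simp only [downs, Finset.mem_image, Finset.mem_range]
  constructor
  · rintro ⟨y, hy, rfl⟩
    exact ⟨row y, (h.le y hy).trans_lt (h.lt y hy), (h.down_eq hy).symm⟩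
  · rintro ⟨i, hi, rfl⟩
    obtain ⟨y, hy, rfl⟩ := h.row_surj i hi
    exact ⟨y, hy, h.down_eq hy⟩

theorem card_downs (h : Rep P d row col) : P.downs.card = d := by
  rw [h.downs_eq, Finset.card_image_of_injOn h.injOn, Finset.card_range]

theorem level_eq (h : Rep P d row col) {x : ℕ} (hx : x ∈ P.carrier) : P.level x = row x := by
  have hlt := (h.le x hx).trans_lt (h.lt x hx)
  have : P.downs.filter (fun E => E ⊂ P.down x) =
      (Finset.range (row x)).image fun i => P.carrier.filter fun x => col x < i := by
    ext E
    rw [h.downs_eq, h.down_eq hx]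
    simp only [Finset.mem_filter, Finset.mem_image, Finset.mem_range]
    constructor
    · rintro ⟨⟨i, hi, rfl⟩, hs⟩
      exact ⟨i, (h.ssubset_iff hi).1 hs, rfl⟩
    · rintro ⟨i, hi, rfl⟩
      exact ⟨⟨i, by omega, rfl⟩, (h.ssubset_iff (by omega)).2 hi⟩
  rw [level, this, Finset.card_image_of_injOn (h.injOn.mono ?_), Finset.card_range]
  simpa using hlt.le

theorem mem_maximals (h : Rep P d row col) {x : ℕ} :
    x ∈ P.maximals ↔ x ∈ P.carrier ∧ col x + 1 = d := by
  simp only [maximals, Finset.mem_filter, h.rel]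
  refine and_congr_right fun hx => ?_
  have h1 := h.lt x hx
  constructor
  · intro hm
    obtain ⟨y, hy, hy'⟩ := h.row_surj (d - 1) (by omega)
    have := hm y hy
    by_contra hne
    exact this ⟨hx, hy, by omega⟩
  · rintro h2 y hy ⟨-, -, h3⟩
    have := h.le y hy
    have := h.lt y hy
    omega

theorem mem_downAt (h : Rep P d row col) {i : ℕ} (hi : i < d) {y : ℕ} :
    y ∈ P.downAt i ↔ y ∈ P.carrier ∧ col y < i := by
  simp only [downAt, Finset.mem_filter, h.rel]
  refine and_congr_right fun hy => ?_
  constructor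
  · rintro ⟨x, hx, h1, -, -, h2⟩
    rw [h.level_eq hx] at h1
    omega
  · intro h1
    obtain ⟨x, hx, h2⟩ := h.row_surj i hi
    exact ⟨x, hx, by rw [h.level_eq hx, h2], hy, hx, by omega⟩

theorem eqOn {d' : ℕ} {row' col' : ℕ → ℕ} (h : Rep P d row col) (h' : Rep P d' row' col') :
    d = d' ∧ ∀ x ∈ P.carrier, row x = row' x ∧ col x = col' x := by
  have hd : d = d' := h.card_downs.symm.trans h'.card_downs
  have hrow : ∀ x ∈ P.carrier, row x = row' x := fun x hx =>
    (h.level_eq hx).symm.trans (h'.level_eq hx)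
  refine ⟨hd, fun x hx => ⟨hrow x hx, ?_⟩⟩
  have h1 := h.lt x hx
  have h2 := h'.lt x hx
  rcases lt_trichotomy (col x) (col' x) with h3 | h3 | h3
  · obtain ⟨y, hy, h4⟩ := h.row_surj (col' x) (by omega)
    have h5 := (h'.rel x y).1 ((h.rel x y).2 ⟨hx, hy, by omega⟩)
    have := hrow y hy
    omega
  · exact h3
  · obtain ⟨y, hy, h4⟩ := h'.row_surj (col x) (by omega)
    have h5 := (h.rel x y).1 ((h'.rel x y).2 ⟨hx, hy, by omega⟩)
    have := hrow y hy
    omega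

/-- The effect of the addition step on the intervals, when the positions of the elements are
entries of a matrix. -/
theorem rel_addStep {T : SqMat (ℕ × ℕ)} (h : Rep P T.dim row col) (hT : T.Reg)
    (hpos : ∀ x ∈ P.carrier, T.get (row x) (col x) ≠ 0)
    (hsurj : ∀ i j, T.get i j ≠ 0 → ∃ x ∈ P.carrier, row x = i ∧ col x = j)
    {a z : ℕ} (ha : a ≤ T.dim) (hz : z ∉ P.carrier) (x y : ℕ) :
    (x, y) ∈ (P.addStep a z).rel ↔ x ∈ insert z P.carrier ∧ y ∈ insert z P.carrier ∧
      (if x = z then (T.addStep a).dim - 1 else (T.move a (row x) (col x)).2) <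
        (if y = z then a else (T.move a (row y) (col y)).1) := by
  have hmax : (∀ x ∈ P.maximals, a ≤ P.level x) ↔ a ≤ T.index ∨ T.dim = 0 := by
    constructor
    · intro hm
      by_contra! hc
      obtain ⟨x, hx, h1, h2⟩ := hsurj _ _ (hT.get_index (by omega))
      have := hm x (h.mem_maximals.2 ⟨hx, by omega⟩)
      rw [h.level_eq hx] at this
      omega
    · intro hc x hx
      have hx' := h.mem_maximals.1 hx
      rw [h.level_eq hx'.1]
      by_contra! hlt
      refine hpos x hx'.1 ?_
      rw [show col x = T.dim - 1 by omega]
      exact SqMat.get_of_lt_index (by omega)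
  have hx1 := h.le x
  have hx2 := h.lt x
  have hy1 := h.le y
  have hy2 := h.lt y
  have hr := h.rel x y
  rw [SqMat.dim_addStep]
  unfold addStep SqMat.move
  simp only [h.card_downs, hmax]
  by_cases h1 : a < T.dim
  · by_cases h2 : a ≤ T.index
    · have hd := h.mem_downAt h1 (y := x)
      simp only [h1, h2, not_lt.2 h2, true_or, true_and, false_and, if_true, if_false,
        Finset.mem_union, Finset.mem_product, Finset.mem_singleton, hd, hr, Finset.mem_insert]
      grind
    · have hd := h.mem_downAt h1 (y := x)
      have hm := h.mem_maximals (x := x)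
      have hlx := h.level_eq (x := x)
      have hly := h.level_eq (x := y)
      have h0 : T.dim ≠ 0 := by omega
      simp only [h1, h2, h0, not_le.1 h2, or_false, and_false, and_true, if_true, if_false,
        Finset.mem_union, Finset.mem_product, Finset.mem_singleton, Finset.mem_filter, hd, hr,
        Finset.mem_insert, hm]
      grind
  · simp only [h1, and_false, false_and, if_false,
      Finset.mem_union, Finset.mem_product, Finset.mem_singleton, hr, Finset.mem_insert]
    grind

end Rep

open AscentSeq SqMat

/-- The labels in the blocks `Z` are in the positions `(row x, col x)` where the matrix `T` has
the number of their block as time of creation. -/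
def Located (T : SqMat (ℕ × ℕ)) (Z : List (List ℕ)) (row col : ℕ → ℕ) : Prop :=
  ∀ s B x, Z[s]? = some B → x ∈ B → (T.get (row x) (col x)).2 = s + 1

theorem Located.rep {w : List ℕ} {T : SqMat (ℕ × ℕ)} (hT : Records w T) {Z : List (List ℕ)}
    (hZ : Z.map List.length = rlr w) {row col : ℕ → ℕ} (hl : Located T Z row col)
    {P : LabelledPoset} (hc : P.carrier = Z.flatten.toFinset)
    (hrel : ∀ x y, (x, y) ∈ P.rel ↔ x ∈ P.carrier ∧ y ∈ P.carrier ∧ col x < row y) :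
    Rep P T.dim row col ∧ (∀ x ∈ P.carrier, T.get (row x) (col x) ≠ 0) ∧
      ∀ i j, T.get i j ≠ 0 → ∃ x ∈ P.carrier, row x = i ∧ col x = j := by
  have hpos : ∀ x ∈ P.carrier, T.get (row x) (col x) ≠ 0 := by
    intro x hx
    rw [hc, List.mem_toFinset, List.mem_flatten] at hx
    obtain ⟨B, hB, hx⟩ := hx
    obtain ⟨s, hs⟩ := List.mem_iff_getElem?.1 hB
    have := hl s B x hs hx
    intro h0
    rw [h0] at this
    simp at this
  have hsurj : ∀ i j, T.get i j ≠ 0 → ∃ x ∈ P.carrier, row x = i ∧ col x = j := by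
    intro i j h
    have h1 := hT.val i j h
    have h2 := hT.pos i j h
    rw [← hZ, List.getElem?_map, Option.map_eq_some_iff] at h1
    obtain ⟨B, hB, hBl⟩ := h1
    obtain ⟨x, hx⟩ := List.exists_mem_of_length_pos (l := B) (by omega)
    have hxc : x ∈ P.carrier := by
      rw [hc, List.mem_toFinset, List.mem_flatten]
      exact ⟨B, List.mem_of_getElem? hB, hx⟩
    exact ⟨x, hxc, hT.inj _ _ _ _ (hpos x hxc) h ((hl _ B x hB hx).trans (by omega))⟩
  refine ⟨⟨hrel, fun x hx => hT.reg.le_of_get_ne (hpos x hx),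
    fun x hx => (lt_of_get_ne T (hpos x hx)).2, fun i hi => ?_, fun j hj => ?_⟩, hpos, hsurj⟩
  · obtain ⟨j, hj⟩ := hT.reg.row i hi
    obtain ⟨x, hx, h1, -⟩ := hsurj i j hj
    exact ⟨x, hx, h1⟩
  · obtain ⟨i, hi⟩ := hT.reg.col j hj
    obtain ⟨x, hx, -, h1⟩ := hsurj i j hi
    exact ⟨x, hx, h1⟩

/-- The poset constructed from a sequence and a word of labels. -/
def ofWord (w z : List ℕ) : LabelledPoset :=
  (w.zip z).foldl (fun P p => P.addStep p.1 p.2) ⟨∅, ∅⟩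

theorem sum_rlr (w : List ℕ) : (rlr w).sum = w.length := by
  rw [rlr, ← List.length_flatten, List.flatten_splitBy]

theorem eq_append_of_map_length {Z : List (List ℕ)} {w : List ℕ} {a : ℕ}
    (hZ : Z.map List.length = rlr (w ++ [a])) :
    ∃ (Y : List (List ℕ)) (z : ℕ), Y.map List.length = rlr w ∧ Z.flatten = Y.flatten ++ [z] ∧
      ∀ s B x, Z[s]? = some B → x ∈ B → (∃ C, Y[s]? = some C ∧ x ∈ C) ∨
        x = z ∧ s + 1 = if w.getLast? = some a then (rlr w).length else (rlr w).length + 1 := by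
  by_cases h : w.getLast? = some a
  · obtain ⟨L, c, h1, h2⟩ := rlr_append_of_eq h
    rw [h2] at hZ
    obtain ⟨Y, E, rfl, hY, hE⟩ := List.map_eq_append_iff.1 hZ
    obtain ⟨l, rfl, hl⟩ : ∃ l, E = [l] ∧ l.length = c + 1 := by
      simpa [List.map_eq_singleton_iff] using hE
    obtain ⟨l, z, rfl⟩ : ∃ l' z, l = l' ++ [z] :=
      ⟨_, _, (List.dropLast_append_getLast (List.length_pos_iff.1 (by omega))).symm⟩
    have hYL : Y.length = L.length := by rw [← hY, List.length_map]
    refine ⟨Y ++ [l], z, by simpa [hY, h1] using hl, by simp, fun s B x hs hx => ?_⟩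
    rw [if_pos h, h1]
    rw [List.getElem?_append] at hs ⊢
    split_ifs at hs ⊢ with h3
    · exact Or.inl ⟨B, hs, hx⟩
    · obtain ⟨h4, h5⟩ : s - Y.length = 0 ∧ l ++ [z] = B := by
        simpa [List.getElem?_singleton] using hs
      subst h5
      rw [h4]
      rcases List.mem_append.1 hx with hx | hx
      · exact Or.inl ⟨l, rfl, hx⟩
      · right
        refine ⟨by simpa using hx, ?_⟩
        simp only [List.length_append, List.length_singleton]
        omega
  · rw [rlr_append_of_ne (by rintro x hx rfl; exact h hx)] at hZ
    obtain ⟨Y, E, rfl, hY, hE⟩ := List.map_eq_append_iff.1 hZ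
    obtain ⟨l, rfl, hl⟩ : ∃ l, E = [l] ∧ l.length = 1 := by
      simpa [List.map_eq_singleton_iff] using hE
    obtain ⟨z, rfl⟩ := List.length_eq_one_iff.1 hl
    have hYL : Y.length = (rlr w).length := by rw [← hY, List.length_map]
    refine ⟨Y, z, hY, by simp, fun s B x hs hx => ?_⟩
    rw [if_neg h]
    rw [List.getElem?_append] at hs
    split_ifs at hs with h3
    · exact Or.inl ⟨B, hs, hx⟩
    · obtain ⟨h4, h5⟩ : s - Y.length = 0 ∧ [z] = B := by
        simpa [List.getElem?_singleton] using hs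
      subst h5
      exact Or.inr ⟨by simpa using hx, by omega⟩

theorem exists_located (w : List ℕ) {n : ℕ} (hw : w ∈ ascents n) {Z : List (List ℕ)}
    (hZ : Z.map List.length = rlr w) (hnd : Z.flatten.Nodup) :
    (ofWord w Z.flatten).carrier = Z.flatten.toFinset ∧
    ∃ row col, Located (build w) Z row col ∧
      ∀ x y, (x, y) ∈ (ofWord w Z.flatten).rel ↔ x ∈ (ofWord w Z.flatten).carrier ∧
        y ∈ (ofWord w Z.flatten).carrier ∧ col x < row y := by
  induction w using List.reverseRecOn generalizing n Z with
  | nil =>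
    obtain rfl : Z = [] := by simpa [rlr] using hZ
    refine ⟨rfl, fun _ => 0, fun _ => 0, ?_, ?_⟩
    · intro s B x hs; simp at hs
    · intro x y; simp [ofWord]
  | append_singleton w a ih =>
    cases n with
    | zero => simp [mem_ascents_zero] at hw
    | succ n =>
      obtain ⟨hw', ha⟩ := append_mem_ascents.1 hw
      obtain ⟨Y, z, hY, hYZ, hmem⟩ := eq_append_of_map_length hZ
      rw [hYZ, List.nodup_append] at hnd
      obtain ⟨hc, row, col, hloc, hrel⟩ := ih hw' hY hnd.1
      have hT := records_build w hw'
      rw [← hT.dim_eq] at ha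
      obtain ⟨hrep, hpos, hsurj⟩ := hloc.rep hT hY hc hrel
      have hz : z ∉ (ofWord w Y.flatten).carrier := by
        rw [hc, List.mem_toFinset]
        intro h
        exact hnd.2.2 z h z (by simp) rfl
      have hP : ofWord (w ++ [a]) Z.flatten = (ofWord w Y.flatten).addStep a z := by
        rw [ofWord, hYZ, List.zip_append]
        · simp [ofWord]
        · rw [List.length_flatten, hY, sum_rlr]
      have hcar : ((ofWord w Y.flatten).addStep a z).carrier =
        insert z (ofWord w Y.flatten).carrier := rfl
      rw [hP, build_append]
      refine ⟨?_, fun x => if x = z then a else ((build w).move a (row x) (col x)).1,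
        fun x => if x = z then ((build w).addStep a).dim - 1 else
          ((build w).move a (row x) (col x)).2, ?_, ?_⟩
      · rw [hcar, hc, hYZ]
        ext x
        simp
      · intro s B x hs hx
        rcases hmem s B x hs hx with ⟨C, hC, hxC⟩ | ⟨rfl, hs'⟩
        · have hxY : x ∈ (ofWord w Y.flatten).carrier := by
            rw [hc, List.mem_toFinset, List.mem_flatten]
            exact ⟨C, List.mem_of_getElem? hC, hxC⟩
          have hxz : x ≠ z := fun h => hz (h ▸ hxY)
          simp only [hxz, if_false]
          rw [hT.snd_move ha (hpos x hxY)]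
          exact hloc s C x hC hxC
        · simp only [if_true]
          rw [hT.snd_target ha, ← hs']
      · intro x y
        rw [hcar]
        exact hrep.rel_addStep hT.reg hpos hsurj ha hz x y

attribute [local instance] finsetZero

theorem ofMad_phi {n : ℕ} {A : SqMat (Finset ℕ)} (hA : A ∈ compMatrices n) :
    ∃ row col, Rep ⟨Finset.Icc 1 n, ofMad (phi A)⟩ A.dim row col ∧
      ∀ i j x, x ∈ A.get i j ↔ x ∈ Finset.Icc 1 n ∧ row x = i ∧ col x = j := by
  obtain ⟨hw, h1, h2, h3, h4⟩ := phi_mem_mad hA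
  have hg := (gamma_spec (card_mem_intMatrices hA)).2
  have hT := records_build _ hw
  set Z : List (List ℕ) := (phi A).2.map fun X => X.sort with hZ
  have hZl : Z.map List.length = rlr (phi A).1 := by
    rw [← h4, hZ, List.map_map]
    refine List.map_congr_left fun X _ => ?_
    simp
  have hnd : Z.flatten.Nodup := by
    rw [List.nodup_flatten]
    constructor
    · intro l hl
      obtain ⟨X, -, rfl⟩ := List.mem_map.1 hl
      exact Finset.sort_nodup _ _
    · rw [hZ, List.pairwise_map]
      refine h2.imp fun {X Y} h x hx hy => ?_
      rw [Finset.mem_sort] at hx hy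
      exact Finset.disjoint_left.1 h hx hy
  obtain ⟨hc, row, col, hloc, hrel⟩ := exists_located _ hw hZl hnd
  have hcar : (ofWord (phi A).1 Z.flatten).carrier = Finset.Icc 1 n := by
    rw [hc]
    ext x
    rw [h3, List.mem_toFinset, List.mem_flatten]
    simp [hZ]
  obtain ⟨hrep, hpos, -⟩ := hloc.rep hT hZl hc hrel
  have hP : (⟨Finset.Icc 1 n, ofMad (phi A)⟩ : LabelledPoset) = ofWord (phi A).1 Z.flatten := by
    rw [← hcar]
    rfl
  have hd : A.dim = (build (phi A).1).dim := congrArg SqMat.dim hg.symm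
  obtain ⟨hreg, hdisj, hcov⟩ := mem_compMatrices.1 hA
  have key : ∀ i j x, x ∈ A.get i j → row x = i ∧ col x = j := by
    intro i j x hx
    have hcard : 0 < (A.get i j).card := Finset.card_pos.2 ⟨x, hx⟩
    rw [← get_card, ← hg, get_gammaInv] at hcard
    have h0 : (build (phi A).1).get i j ≠ 0 := by
      intro h
      change 0 < ((build (phi A).1).get i j).1 at hcard
      rw [h] at hcard
      simp at hcard
    have h5 := (hT.pos i j h0).2
    have h6 := getElem?_setSystem hw hg.symm (i := i) (j := j)
      (s := ((build (phi A).1).get i j).2 - 1) (Nat.sub_add_cancel h5).symm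
    have h7 : Z[((build (phi A).1).get i j).2 - 1]? = some (A.get i j).sort := by
      rw [hZ, List.getElem?_map]
      change Option.map _ (A.setSystem[((build (phi A).1).get i j).2 - 1]?) = _
      rw [h6]
      rfl
    have h8 := hloc _ _ x h7 (by simpa using hx)
    have hxc : x ∈ (ofWord (phi A).1 Z.flatten).carrier := by
      rw [hcar, hcov]; exact ⟨i, j, hx⟩
    exact hT.inj _ _ _ _ (hpos x hxc) h0 (by omega)
  refine ⟨row, col, by rw [hP, hd]; exact hrep, fun i j x => ⟨fun hx => ?_, ?_⟩⟩
  · exact ⟨(hcov x).2 ⟨i, j, hx⟩, key i j x hx⟩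
  · rintro ⟨hx, rfl, rfl⟩
    obtain ⟨i, j, hij⟩ := (hcov x).1 hx
    obtain ⟨rfl, rfl⟩ := key i j x hij
    exact hij

end LabelledPoset

namespace LabelledPoset

open SqMat

theorem Rep.mem_twoTwoFree {n d : ℕ} {R : Finset (ℕ × ℕ)} {row col : ℕ → ℕ}
    (h : Rep ⟨Finset.Icc 1 n, R⟩ d row col) : R ∈ twoTwoFree n := by
  have hrel := h.rel
  have hle := h.le
  dsimp only at hrel hle
  refine ⟨?_, ?_, ?_, ⟨fun f => ?_⟩⟩
  · rintro ⟨x, y⟩ hxy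
    have := (hrel x y).1 hxy
    exact Finset.mem_product.2 ⟨this.1, this.2.1⟩
  · intro x hx
    have := (hrel x x).1 hx
    have := hle x this.1
    omega
  · intro x y z hxy hyz
    have h1 := (hrel x y).1 hxy
    have h2 := (hrel y z).1 hyz
    have := hle y h1.2.1
    exact (hrel x z).2 ⟨h1.1, h2.2.1, by omega⟩
  · have h1 := (hrel _ _).1 (f.map_rel_iff.2 (show (Sum.inl 0 : Fin 2 ⊕ Fin 2) < Sum.inl 1 by simp))
    have h2 := (hrel _ _).1 (f.map_rel_iff.2 (show (Sum.inr 0 : Fin 2 ⊕ Fin 2) < Sum.inr 1 by simp))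
    rcases le_total (row (f (Sum.inl 1))) (row (f (Sum.inr 1))) with h3 | h3
    · have := f.map_rel_iff.1 ((hrel (f (Sum.inl 0)) (f (Sum.inr 1))).2 ⟨h1.1, h2.2.1, by omega⟩)
      simp at this
    · have := f.map_rel_iff.1 ((hrel (f (Sum.inr 0)) (f (Sum.inl 1))).2 ⟨h2.1, h1.2.1, by omega⟩)
      simp at this

theorem down_subset_or {n : ℕ} {R : Finset (ℕ × ℕ)} (hR : R ∈ twoTwoFree n) (x y : ℕ) :
    down ⟨Finset.Icc 1 n, R⟩ x ⊆ down ⟨Finset.Icc 1 n, R⟩ y ∨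
      down ⟨Finset.Icc 1 n, R⟩ y ⊆ down ⟨Finset.Icc 1 n, R⟩ x := by
  obtain ⟨hsub, hirr, htr, ⟨hfree⟩⟩ := hR
  by_contra! hc
  obtain ⟨a, ha, ha'⟩ := Finset.not_subset.1 hc.1
  obtain ⟨b, hb, hb'⟩ := Finset.not_subset.1 hc.2
  simp only [down, Finset.mem_filter, not_and] at ha ha' hb hb'
  have h1 := ha.2
  have h2 := hb.2
  have h3 := ha' ha.1
  have h4 := hb' hb.1
  have hax : (x, a) ∉ R := fun h => hirr _ (htr _ _ _ h h1)
  have hby : (y, b) ∉ R := fun h => hirr _ (htr _ _ _ h h2)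
  have hab : (a, b) ∉ R := fun h => h3 (htr _ _ _ h h2)
  have hba : (b, a) ∉ R := fun h => h4 (htr _ _ _ h h1)
  have hxb : (x, b) ∉ R := fun h => hab (htr _ _ _ h1 h)
  have hya : (y, a) ∉ R := fun h => hba (htr _ _ _ h2 h)
  have hxy : (x, y) ∉ R := fun h => h3 (htr _ _ _ h1 h)
  have hyx : (y, x) ∉ R := fun h => h4 (htr _ _ _ h2 h)
  have e1 : a ≠ x := fun h => hirr x (h ▸ h1)
  have e2 : b ≠ y := fun h => hirr y (h ▸ h2)
  have e3 : a ≠ b := fun h => h4 (h ▸ h1)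
  have e4 : a ≠ y := fun h => hba (h ▸ h2)
  have e5 : b ≠ x := fun h => hab (h ▸ h1)
  have e6 : x ≠ y := fun h => h3 (h ▸ h1)
  let f : Fin 2 ⊕ Fin 2 → ℕ := Sum.elim ![a, x] ![b, y]
  have hinj : Function.Injective f := by
    rintro (i | i) (j | j) hij <;> fin_cases i <;> fin_cases j <;>
      first
      | rfl
      | (simp [f, e1, e2, e3, e4, e5, e6, e1.symm, e2.symm, e3.symm, e4.symm, e5.symm,
          e6.symm] at hij)
  have hrel : ∀ u v, (f u, f v) ∈ R ↔ u < v := by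
    rintro (i | i) (j | j) <;> fin_cases i <;> fin_cases j <;>
      simp [f, hirr, h1, h2, h3, h4, hax, hby, hab, hba, hxb, hya, hxy, hyx]
  exact hfree ⟨⟨f, hinj⟩, fun {u v} => hrel u v⟩

theorem exists_rep {n : ℕ} {R : Finset (ℕ × ℕ)} (hR : R ∈ twoTwoFree n) :
    ∃ d row col, Rep ⟨Finset.Icc 1 n, R⟩ d row col := by
  set P : LabelledPoset := ⟨Finset.Icc 1 n, R⟩ with hP
  have hirr := hR.2.1
  have hchain : ∀ E ∈ P.downs, ∀ F ∈ P.downs, E ⊂ F ∨ E = F ∨ F ⊂ E := by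
    intro E hE F hF
    obtain ⟨x, -, rfl⟩ := Finset.mem_image.1 hE
    obtain ⟨y, -, rfl⟩ := Finset.mem_image.1 hF
    rcases down_subset_or hR x y with h | h
    · rcases h.eq_or_ssubset with h | h
      · exact Or.inr (Or.inl h)
      · exact Or.inl h
    · rcases h.eq_or_ssubset with h | h
      · exact Or.inr (Or.inl h.symm)
      · exact Or.inr (Or.inr h)
  let rank : Finset ℕ → ℕ := fun E => (P.downs.filter fun F => F ⊂ E).card
  let co : ℕ → ℕ := fun x => (P.downs.filter fun F => x ∉ F).card
  have hrank_lt : ∀ E ∈ P.downs, rank E < P.downs.card := by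
    intro E hE
    exact Finset.card_lt_card (Finset.filter_ssubset.2 ⟨E, hE, fun h => h.ne rfl⟩)
  have hmono : ∀ E ∈ P.downs, ∀ F, E ⊂ F → rank E < rank F := by
    intro E hE F h
    apply Finset.card_lt_card
    refine ⟨fun G hG => ?_, fun hs => ?_⟩
    · rw [Finset.mem_filter] at hG ⊢
      exact ⟨hG.1, hG.2.trans h⟩
    · have := hs (Finset.mem_filter.2 ⟨hE, h⟩)
      exact (Finset.mem_filter.1 this).2.ne rfl
  have hsurj : ∀ i < P.downs.card, ∃ y ∈ P.carrier, rank (P.down y) = i := by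
    have hinj : Set.InjOn rank P.downs := by
      intro E hE F hF h
      rcases hchain E hE F hF with h1 | h1 | h1
      · exact absurd h (hmono E hE F h1).ne
      · exact h1
      · exact absurd h (hmono F hF E h1).ne'
    have himg : P.downs.image rank = Finset.range P.downs.card := by
      apply Finset.eq_of_subset_of_card_le
      · intro i hi
        obtain ⟨E, hE, rfl⟩ := Finset.mem_image.1 hi
        exact Finset.mem_range.2 (hrank_lt E hE)
      · rw [Finset.card_image_of_injOn hinj, Finset.card_range]
    intro i hi
    rw [← Finset.mem_range, ← himg, Finset.mem_image] at hi
    obtain ⟨E, hE, rfl⟩ := hi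
    obtain ⟨y, hy, rfl⟩ := Finset.mem_image.1 hE
    exact ⟨y, hy, rfl⟩
  have hmem : ∀ x, ∀ E ∈ P.downs, x ∈ E ↔ co x ≤ rank E := by
    intro x E hE
    constructor
    · intro hx
      apply Finset.card_le_card
      intro F hF
      rw [Finset.mem_filter] at hF ⊢
      refine ⟨hF.1, ?_⟩
      rcases hchain F hF.1 E hE with h | h | h
      · exact h
      · exact absurd (h ▸ hx) hF.2
      · exact absurd (h.1 hx) hF.2
    · intro h
      by_contra hx
      refine not_lt.2 h (Finset.card_lt_card ⟨fun F hF => ?_, fun hs => ?_⟩)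
      · rw [Finset.mem_filter] at hF ⊢
        exact ⟨hF.1, fun hxF => hx (hF.2.1 hxF)⟩
      · have := hs (Finset.mem_filter.2 ⟨hE, hx⟩)
        exact (Finset.mem_filter.1 this).2.ne rfl
  have hdown : ∀ x ∈ P.carrier, P.down x ∈ P.downs := fun x hx => Finset.mem_image_of_mem _ hx
  have hself : ∀ x ∈ P.carrier, rank (P.down x) < co x := by
    intro x hx
    rw [← not_le, ← hmem x _ (hdown x hx)]
    intro h
    exact hirr x (Finset.mem_filter.1 h).2
  have hco : ∀ x, co x ≤ P.downs.card := fun x => Finset.card_filter_le _ _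
  refine ⟨P.downs.card, fun x => rank (P.down x), fun x => co x - 1, ?_, ?_, ?_, hsurj, ?_⟩
  · intro x y
    have hxy : (x, y) ∈ P.rel → x ∈ P.carrier ∧ y ∈ P.carrier :=
      fun h => Finset.mem_product.1 (hR.1 h)
    constructor
    · intro h
      obtain ⟨hx, hy⟩ := hxy h
      have h1 := (hmem x _ (hdown y hy)).1 (Finset.mem_filter.2 ⟨hx, h⟩)
      have := hself x hx
      exact ⟨hx, hy, by omega⟩
    · rintro ⟨hx, hy, h⟩
      have h1 := (hmem x _ (hdown y hy)).2 (by omega)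
      exact (Finset.mem_filter.1 h1).2
  · intro x hx
    have := hself x hx
    omega
  · intro x hx
    have := hself x hx
    have := hco x
    omega
  · intro j hj
    obtain ⟨y, hy, h1⟩ := hsurj j hj
    by_cases hj' : j + 1 < P.downs.card
    · obtain ⟨y', hy', h2⟩ := hsurj (j + 1) hj'
      have hss : P.down y ⊂ P.down y' := by
        rcases hchain _ (hdown y hy) _ (hdown y' hy') with h | h | h
        · exact h
        · rw [h] at h1; omega
        · have := hmono _ (hdown y' hy') _ h; omega
      obtain ⟨x, hx, hx'⟩ := Finset.exists_of_ssubset hss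
      rw [hmem x _ (hdown y hy)] at hx'
      have hxc := (Finset.mem_filter.1 hx).1
      rw [hmem x _ (hdown y' hy')] at hx
      exact ⟨x, hxc, by omega⟩
    · have := hself y hy
      have := hco y
      exact ⟨y, hy, by omega⟩

attribute [local instance] finsetZero

theorem Rep.exists_mem_compMatrices {n d : ℕ} {R : Finset (ℕ × ℕ)} {row col : ℕ → ℕ}
    (h : Rep ⟨Finset.Icc 1 n, R⟩ d row col) :
    ∃ A ∈ compMatrices n, ∀ i j x, x ∈ A.get i j ↔ x ∈ Finset.Icc 1 n ∧ row x = i ∧ col x = j := by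
  have hget : ∀ i j x, x ∈ (ofFun d fun i j => (Finset.Icc 1 n).filter fun x =>
      row x = i ∧ col x = j).get i j ↔ x ∈ Finset.Icc 1 n ∧ row x = i ∧ col x = j := by
    intro i j x
    rw [get_ofFun]
    split_ifs with hij
    · exact Finset.mem_filter
    · constructor
      · intro hx
        rw [finset_zero_eq] at hx
        simp at hx
      · rintro ⟨hx, rfl, rfl⟩
        have h1 := h.le x hx
        have h2 := h.lt x hx
        omega
  have hne : ∀ x ∈ Finset.Icc 1 n, (ofFun d fun i j => (Finset.Icc 1 n).filter fun x =>
      row x = i ∧ col x = j).get (row x) (col x) ≠ 0 := by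
    intro x hx h0
    have := (hget (row x) (col x) x).2 ⟨hx, rfl, rfl⟩
    rw [h0, finset_zero_eq] at this
    simp at this
  refine ⟨_, mem_compMatrices.2 ⟨⟨fun i j hij => ?_, fun i hi => ?_, fun j hj => ?_⟩, ?_, ?_⟩, hget⟩
  · rw [finset_zero_eq, Finset.eq_empty_iff_forall_notMem]
    intro x hx
    obtain ⟨hxc, rfl, rfl⟩ := (hget i j x).1 hx
    have := h.le x hxc
    omega
  · obtain ⟨x, hx, rfl⟩ := h.row_surj i hi
    exact ⟨_, hne x hx⟩
  · obtain ⟨x, hx, rfl⟩ := h.col_surj j hj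
    exact ⟨_, hne x hx⟩
  · intro i j i' j' hp
    rw [Finset.disjoint_left]
    intro x hx hx'
    obtain ⟨-, rfl, rfl⟩ := (hget i j x).1 hx
    obtain ⟨-, rfl, rfl⟩ := (hget i' j' x).1 hx'
    exact hp rfl
  · intro x
    constructor
    · intro hx
      exact ⟨_, _, (hget _ _ x).2 ⟨hx, rfl, rfl⟩⟩
    · rintro ⟨i, j, hx⟩
      exact ((hget i j x).1 hx).1

theorem bijOn_ofMad_phi (n : ℕ) :
    Set.BijOn (fun A => ofMad (phi A)) (compMatrices n) (twoTwoFree n) := by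
  refine ⟨fun A hA => ?_, fun A hA B hB hAB => ?_, fun R hR => ?_⟩
  · obtain ⟨row, col, h, -⟩ := ofMad_phi hA
    exact h.mem_twoTwoFree
  · obtain ⟨row, col, h, hget⟩ := ofMad_phi hA
    obtain ⟨row', col', h', hget'⟩ := ofMad_phi hB
    dsimp only at hAB
    rw [← hAB] at h'
    obtain ⟨hd, heq⟩ := h.eqOn h'
    refine ext_get hd fun i j _ _ => ?_
    ext x
    rw [hget, hget']
    refine and_congr_right fun hx => ?_
    rw [(heq x hx).1, (heq x hx).2]
  · obtain ⟨d, row, col, h⟩ := exists_rep hR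
    obtain ⟨A, hA, hget⟩ := h.exists_mem_compMatrices
    refine ⟨A, hA, ?_⟩
    obtain ⟨row', col', h', hget'⟩ := ofMad_phi hA
    have heq : ∀ x ∈ Finset.Icc 1 n, row' x = row x ∧ col' x = col x := by
      intro x hx
      have := (hget' _ _ x).1 ((hget _ _ x).2 ⟨hx, rfl, rfl⟩)
      exact this.2
    have hr := h.rel
    have hr' := h'.rel
    dsimp only at hr hr'
    ext ⟨x, y⟩
    rw [hr, hr']
    refine and_congr_right fun hx => and_congr_right fun hy => ?_
    rw [(heq x hx).2, (heq y hy).1]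

end LabelledPoset

theorem theorem16 (n : ℕ) :
    (Set.BijOn SqMat.gamma (SqMat.intMatrices n) (AscentSeq.ascents n) ∧
      Set.InvOn SqMat.gammaInv SqMat.gamma (SqMat.intMatrices n) (AscentSeq.ascents n)) ∧
    (Set.BijOn SqMat.phi (SqMat.compMatrices n) (AscentSeq.mad n) ∧
      Set.InvOn SqMat.psi SqMat.phi (SqMat.compMatrices n) (AscentSeq.mad n)) ∧
    Set.BijOn (fun A => LabelledPoset.ofMad (SqMat.phi A))
      (SqMat.compMatrices n) (LabelledPoset.twoTwoFree n) := by
  have h1 : Set.InvOn SqMat.gammaInv SqMat.gamma (SqMat.intMatrices n) (AscentSeq.ascents n) :=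
    ⟨fun _ hA => (SqMat.gamma_spec hA).2, fun w hw => (SqMat.gammaInv_spec w hw).2.2⟩
  have h2 : Set.InvOn SqMat.psi SqMat.phi (SqMat.compMatrices n) (AscentSeq.mad n) :=
    ⟨fun _ hA => SqMat.psi_phi hA, fun _ hm => (SqMat.psi_spec hm).2⟩
  exact ⟨⟨h1.bijOn (fun _ hA => (SqMat.gamma_spec hA).1)
      fun w hw => (SqMat.gammaInv_spec w hw).1, h1⟩,
    ⟨h2.bijOn (fun _ hA => SqMat.phi_mem_mad hA) fun _ hm => (SqMat.psi_spec hm).1, h2⟩,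
    LabelledPoset.bijOn_ofMad_phi n⟩
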